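/- Let $n\ge 2$, let $S^n$ be the unit sphere in $\mathbb R^{n+1}$, $-1<a\le 1$, $S^n_a=\{\eta\in S^n:\eta_{n+1}<a\}$ and $\sigma_k=2\pi^{(k+1)/2}/\Gamma((k+1)/2)$. For $\xi\in S^n$ with $0\le\xi_{n+1}<1$ put $$(S_af)(\xi)=\int_{\gamma_a(\xi)}f(\eta)\,d_{\gamma_a}\eta,\qquad \gamma_a(\xi)=\{\eta\in S^n_a:\ \xi\cdot\eta=a\xi_{n+1}\},$$ where $d_{\gamma_a}\eta$ is the $(n-1)$-dimensional surface measure on $\gamma_a(\xi)$. For $r\ge0$ let $$D_0(r)=\sqrt{a+1}\sqrt{r^2(1-a)+a+1},\quad P_0(r)=\frac{a(a+1)+D_0(r)}{r^2+(a+1)^2},\quad Q_0(r)=\frac{ar^2-(a+1)D_0(r)}{r^2+(a+1)^2}.$$ For $x\in\mathbb R^n$, a unit vector $\theta\in S^{n-1}\subset\mathbb R^n$, $t\in\mathbb R$ and $\xi=\sqrt{1-s^2}\,\theta+se_{n+1}$ with $0\le s<1$, let $$(U_af)(x)=\frac{(a+1)P_0(|x|)^{n-1}}{D_0(|x|)}\,f\big(P_0(|x|)x+Q_0(|x|)e_{n+1}\big),\qquad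 (Rg)(\theta,t)=\int_{\theta^\perp}g(t\theta+u)\,du,$$ $$(V_a\Phi)(\xi)=\sqrt{\frac{1-a^2s^2}{1-s^2}}\;\Phi\Big(\theta,\frac{(a+1)s}{\sqrt{1-s^2}}\Big),$$ and let their one-variable forms be $$(\mathring U_af_0)(r)=\frac{(a+1)P_0(r)^{n-1}}{D_0(r)}f_0(Q_0(r)),\quad(\mathring Rg_0)(t)=\sigma_{n-2}\int_t^\infty g_0(r)(r^2-t^2)^{(n-3)/2}r\,dr,$$ $$(\mathring V_a\Phi_0)(s)=\sqrt{\frac{1-a^2s^2}{1-s^2}}\;\Phi_0\Big(\frac{(a+1)s}{\sqrt{1-s^2}}\Big).$$ Let $f$ be zonal on $S^n_a$, $f(\eta)=f_0(\eta_{n+1})$, with $f_0:(-1,a)\to\mathbb C$ measurable. Then for every $\xi\in S^n$ with $0\le\xi_{n+1}<1$ $$(S_af)(\xi)=(V_aRU_af)(\xi)=(\mathring V_a\mathring R\mathring U_af_0)(\xi_{n+1}),$$ where the integrals defining the three expressions exist in the Lebesgue sense simultaneously. They exist for almost all $\xi\in S^n$ with $\xi_{n+1}\ge0$ if $\int_{-1}^a|f_0(t)|(1-t^2)^{(n-2)/2}dt<\infty$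 (when $a<1$), respectively if $\int_{-1}^1|f_0(t)|(1-t)^{(n-3)/2}(1+t)^{(n-2)/2}dt<\infty$ (when $a=1$). In particular, for every $\xi\in S^n$ with $0\le\xi_{n+1}<1$ (with simultaneous existence of the integrals on both sides): (i) if $a=0$, then $(S_0f)(\xi)=F_0\big(\sqrt{1-\xi_{n+1}^2}\big)$, where $$F_0(\rho)=\frac{\sigma_{n-2}}{\rho^{n-2}}\int_0^\rho f_0(-t)(\rho^2-t^2)^{(n-3)/2}\,dt;$$ (ii) if $a=1$, then $(S_1f)(\xi)=F_1(2\xi_{n+1}^2-1)$, where $$F_1(\rho)=\sigma_{n-2}\Big(\frac{1-\rho}{2}\Big)^{(3-n)/2}\int_\rho^1 f_0(t)\,(t-\rho)^{(n-3)/2}(1-t)^{(n-3)/2}\,dt.$$ -/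

import Mathlib

open MeasureTheory Set

noncomputable section

namespace SphericalSlice

/-- `ℝᵏ` with its Euclidean structure. -/
abbrev E (k : ℕ) : Type := EuclideanSpace ℝ (Fin k)

/-- `σ_k = 2 π^((k+1)/2) / Γ((k+1)/2)`, the area of the unit sphere `S^k` in `ℝ^(k+1)`. -/
def sphereArea (k : ℕ) : ℝ :=
  2 * Real.pi ^ (((k : ℝ) + 1) / 2) / Real.Gamma (((k : ℝ) + 1) / 2)

/-- The point of `ℝ^(n+1) = ℝⁿ × ℝ` with horizontal part `x` and last coordinate `q`. -/
def withHeight {n : ℕ} (x : E n) (q : ℝ) : E (n + 1) :=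
  WithLp.toLp 2 (Fin.snoc (α := fun _ => ℝ) (fun i => x i) q)

/-- The horizontal part `(ξ₁, …, ξ_n)` of `ξ ∈ ℝ^(n+1)`. -/
def horizontal {n : ℕ} (ξ : E (n + 1)) : E n :=
  WithLp.toLp 2 (fun i : Fin n => ξ i.castSucc)

/-- The last coordinate `ξ_{n+1}`. -/
def height {n : ℕ} (ξ : E (n + 1)) : ℝ := ξ (Fin.last n)

/-- The point `A = (0, …, 0, a)`. -/
def center (n : ℕ) (a : ℝ) : E (n + 1) := EuclideanSpace.single (Fin.last n) a

/-- The surface measure of the unit sphere `S^n`. -/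
def sphereMeasure (n : ℕ) : Measure (Metric.sphere (0 : E (n + 1)) 1) :=
  (volume : Measure (E (n + 1))).toSphere

/-- The truncated sphere `S^n_a = {η ∈ S^n : η_{n+1} < a}`. -/
def truncatedSphere (n : ℕ) (a : ℝ) : Set (E (n + 1)) :=
  {η | ‖η‖ = 1 ∧ height η < a}

/-- The complete slice `{η ∈ S^n : ξ · (η - A) = 0}`. -/
def fullSlice {n : ℕ} (a : ℝ) (ξ : E (n + 1)) : Set (E (n + 1)) :=
  {η | ‖η‖ = 1 ∧ inner ℝ ξ (η - center n a) = 0}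

/-- The slice `γ_a(ξ) = {η ∈ S^n_a : ξ · (η - A) = 0}`. -/
def slice {n : ℕ} (a : ℝ) (ξ : E (n + 1)) : Set (E (n + 1)) :=
  {η | η ∈ truncatedSphere n a ∧ inner ℝ ξ (η - center n a) = 0}

/-- The radius `(1 - a² ξ_{n+1}²)^(1/2)` of the `(n-1)`-sphere `fullSlice a ξ`. -/
def sliceRadius {n : ℕ} (a : ℝ) (ξ : E (n + 1)) : ℝ :=
  Real.sqrt (1 - a ^ 2 * height ξ ^ 2)

/-- The similarity from the unit sphere of the hyperplane `ξ^⊥` onto `fullSlice a ξ`. -/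
def slicePoint {n : ℕ} (a : ℝ) (ξ : E (n + 1))
    (ω : Metric.sphere (0 : (Submodule.span ℝ {ξ})ᗮ) 1) : E (n + 1) :=
  (a * height ξ) • ξ + sliceRadius a ξ • ((ω : (Submodule.span ℝ {ξ})ᗮ) : E (n + 1))

/-- The `(n-1)`-dimensional surface measure of the sphere `fullSlice a ξ`: the image of the
surface measure of the unit sphere of `ξ^⊥`, scaled by the `(n-1)`-st power of the radius. -/
def sliceMeasure {n : ℕ} (a : ℝ) (ξ : E (n + 1)) : Measure (E (n + 1)) :=
  ENNReal.ofReal (sliceRadius a ξ ^ (n - 1)) •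
    Measure.map (slicePoint a ξ) (volume : Measure (Submodule.span ℝ {ξ})ᗮ).toSphere

/-- The integral defining `(S_a f)(ξ)` exists in the Lebesgue sense. -/
def SliceIntegrable {n : ℕ} (a : ℝ) (f : E (n + 1) → ℂ) (ξ : E (n + 1)) : Prop :=
  IntegrableOn f (slice a ξ) (sliceMeasure a ξ)

/-- The spherical slice transform `(S_a f)(ξ)`, the integral of `f` over `γ_a(ξ)` with respect
to the surface measure. -/
def sliceTransform {n : ℕ} (a : ℝ) (f : E (n + 1) → ℂ) (ξ : E (n + 1)) : ℂ :=
  ∫ η in slice a ξ, f η ∂(sliceMeasure a ξ)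

/-- `D₀(r) = √(a+1) √(r²(1-a) + a + 1)`. -/
def D₀ (a r : ℝ) : ℝ := Real.sqrt (a + 1) * Real.sqrt (r ^ 2 * (1 - a) + a + 1)

/-- `P₀(r) = (a(a+1) + D₀(r)) / (r² + (a+1)²)`. -/
def P₀ (a r : ℝ) : ℝ := (a * (a + 1) + D₀ a r) / (r ^ 2 + (a + 1) ^ 2)

/-- `Q₀(r) = (a r² - (a+1) D₀(r)) / (r² + (a+1)²)`. -/
def Q₀ (a r : ℝ) : ℝ := (a * r ^ 2 - (a + 1) * D₀ a r) / (r ^ 2 + (a + 1) ^ 2)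

/-- The stereographic projection `π : ℝⁿ → S^n_a` with pole `A`,
`π(x) = P(x) x + Q(x) e_{n+1}`. -/
def stereo {n : ℕ} (a : ℝ) (x : E n) : E (n + 1) :=
  withHeight (P₀ a ‖x‖ • x) (Q₀ a ‖x‖)

/-- `(U_a f)(x) = (a+1) P(x)^(n-1) / D(x) · f(π(x))`. -/
def opU {n : ℕ} (a : ℝ) (f : E (n + 1) → ℂ) (x : E n) : ℂ :=
  ((a + 1) * P₀ a ‖x‖ ^ (n - 1) / D₀ a ‖x‖) • f (stereo a x)

/-- The integral defining the Radon transform at `(θ, t)` exists in the Lebesgue sense. -/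
def RadonIntegrable {n : ℕ} (g : E n → ℂ) (θ : E n) (t : ℝ) : Prop :=
  Integrable (fun u : (Submodule.span ℝ {θ})ᗮ => g (t • θ + (u : E n)))

/-- The hyperplane Radon transform `(R g)(θ, t) = ∫_{θ^⊥} g(tθ + u) du`. -/
def radon {n : ℕ} (g : E n → ℂ) (θ : E n) (t : ℝ) : ℂ :=
  ∫ u : (Submodule.span ℝ {θ})ᗮ, g (t • θ + (u : E n))

/-- The variable `t = (a+1)s / √(1-s²)`. -/
def radonOffset (a s : ℝ) : ℝ := (a + 1) * s / Real.sqrt (1 - s ^ 2)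

/-- The unit vector `θ ∈ S^(n-1)` in `ξ = √(1-s²) θ + s e_{n+1}`, where `s = ξ_{n+1}`. -/
def direction {n : ℕ} (ξ : E (n + 1)) : E n :=
  (Real.sqrt (1 - height ξ ^ 2))⁻¹ • horizontal ξ

/-- `(V_a Φ)(ξ) = √((1-a²s²)/(1-s²)) Φ(θ, (a+1)s/√(1-s²))` for
`ξ = √(1-s²) θ + s e_{n+1}`. -/
def opV {n : ℕ} (a : ℝ) (Φ : E n → ℝ → ℂ) (ξ : E (n + 1)) : ℂ :=
  Real.sqrt ((1 - a ^ 2 * height ξ ^ 2) / (1 - height ξ ^ 2)) •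
    Φ (direction ξ) (radonOffset a (height ξ))

/-- The one-variable form of `U_a`. -/
def opU₀ (n : ℕ) (a : ℝ) (f₀ : ℝ → ℂ) (r : ℝ) : ℂ :=
  ((a + 1) * P₀ a r ^ (n - 1) / D₀ a r) • f₀ (Q₀ a r)

/-- The integrand `g₀(r) (r²-t²)^((n-3)/2) r` of the one-variable Radon transform. -/
def radonIntegrand₀ (n : ℕ) (g₀ : ℝ → ℂ) (t r : ℝ) : ℂ :=
  ((r ^ 2 - t ^ 2) ^ (((n : ℝ) - 3) / 2) * r) • g₀ r

/-- The one-variable form of the Radon transform,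
`σ_{n-2} ∫_t^∞ g₀(r) (r²-t²)^((n-3)/2) r dr`. -/
def radon₀ (n : ℕ) (g₀ : ℝ → ℂ) (t : ℝ) : ℂ :=
  sphereArea (n - 2) • ∫ r in Ioi t, radonIntegrand₀ n g₀ t r

/-- The one-variable form of `V_a`. -/
def opV₀ (a : ℝ) (Φ₀ : ℝ → ℂ) (s : ℝ) : ℂ :=
  Real.sqrt ((1 - a ^ 2 * s ^ 2) / (1 - s ^ 2)) • Φ₀ (radonOffset a s)

/-- The integrand `f₀(-t) (ρ²-t²)^((n-3)/2)`. -/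
def abelIntegrandZero (n : ℕ) (f₀ : ℝ → ℂ) (ρ t : ℝ) : ℂ :=
  ((ρ ^ 2 - t ^ 2) ^ (((n : ℝ) - 3) / 2)) • f₀ (-t)

/-- `F₀(ρ) = σ_{n-2} / ρ^(n-2) ∫_0^ρ f₀(-t) (ρ²-t²)^((n-3)/2) dt`. -/
def abelZero (n : ℕ) (f₀ : ℝ → ℂ) (ρ : ℝ) : ℂ :=
  (sphereArea (n - 2) / ρ ^ (n - 2)) • ∫ t in Ioo 0 ρ, abelIntegrandZero n f₀ ρ t

/-- The integrand `f₀(t) (t-ρ)^((n-3)/2) (1-t)^((n-3)/2)`. -/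
def abelIntegrandOne (n : ℕ) (f₀ : ℝ → ℂ) (ρ t : ℝ) : ℂ :=
  ((t - ρ) ^ (((n : ℝ) - 3) / 2) * (1 - t) ^ (((n : ℝ) - 3) / 2)) • f₀ t

/-- `F₁(ρ) = σ_{n-2} ((1-ρ)/2)^((3-n)/2) ∫_ρ^1 f₀(t) (t-ρ)^((n-3)/2) (1-t)^((n-3)/2) dt`. -/
def abelOne (n : ℕ) (f₀ : ℝ → ℂ) (ρ : ℝ) : ℂ :=
  (sphereArea (n - 2) * ((1 - ρ) / 2) ^ ((3 - (n : ℝ)) / 2)) •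
    ∫ t in Ioo ρ 1, abelIntegrandOne n f₀ ρ t

/-- The weight in the integrability condition on `f₀`: `f₀` times this weight is integrable on
`(-1, a)` exactly when `η ↦ f₀(η_{n+1})` is integrable on `S^n_a` (case `a < 1`), respectively
when `η ↦ f₀(η_{n+1}) / √(1-η_{n+1})` is integrable on `S^n` (case `a = 1`). -/
def zonalWeight (n : ℕ) (a t : ℝ) : ℝ :=
  open Classical in
  if a < 1 then (1 - t ^ 2) ^ (((n : ℝ) - 2) / 2)
  else (1 - t) ^ (((n : ℝ) - 3) / 2) * (1 + t) ^ (((n : ℝ) - 2) / 2)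

/-- The parametrisation used for the surface measure fills exactly the slice. -/
theorem range_slicePoint {n : ℕ} (a : ℝ) (ξ : E (n + 1)) (hξ : ‖ξ‖ = 1)
    (hr : a ^ 2 * height ξ ^ 2 < 1) : range (slicePoint a ξ) = fullSlice a ξ := by
  have hr0 : 0 < 1 - a ^ 2 * height ξ ^ 2 := by linarith
  have hrp : 0 < sliceRadius a ξ := Real.sqrt_pos.2 hr0
  have hrsq : sliceRadius a ξ ^ 2 = 1 - a ^ 2 * height ξ ^ 2 := Real.sq_sqrt hr0.le
  have hc : inner ℝ ξ (center n a) = a * height ξ := by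
    simp [center, height, EuclideanSpace.inner_single_right]
  have hξξ : inner ℝ ξ ξ = (1 : ℝ) := by simp [hξ]
  ext η
  constructor
  · rintro ⟨ω, rfl⟩
    have hω : inner ℝ ξ ((ω : (Submodule.span ℝ {ξ})ᗮ) : E (n + 1)) = 0 :=
      Submodule.mem_orthogonal_singleton_iff_inner_right.1 ω.1.2
    have hn : ‖((ω : (Submodule.span ℝ {ξ})ᗮ) : E (n + 1))‖ = 1 := by
      rw [Submodule.norm_coe]
      exact mem_sphere_zero_iff_norm.1 ω.2
    refine ⟨?_, ?_⟩
    · have h2 : ‖slicePoint a ξ ω‖ ^ 2 = 1 := by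
        rw [slicePoint, norm_add_sq_real, norm_smul, norm_smul, inner_smul_left,
          inner_smul_right, hω, hξ, hn]
        simp only [Real.norm_eq_abs, mul_one, sq_abs, hrsq]
        simp; ring
      nlinarith [norm_nonneg (slicePoint a ξ ω)]
    · rw [inner_sub_right, hc, slicePoint, inner_add_right, inner_smul_right, inner_smul_right,
        hω, hξξ]
      ring
  · rintro ⟨h1, h2⟩
    rw [inner_sub_right, hc] at h2
    have hmem : (sliceRadius a ξ)⁻¹ • (η - (a * height ξ) • ξ) ∈ (Submodule.span ℝ {ξ})ᗮ := by
      rw [Submodule.mem_orthogonal_singleton_iff_inner_right, inner_smul_right, inner_sub_right,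
        inner_smul_right, hξξ]
      rw [mul_one, h2, mul_zero]
    have hsq : ‖η - (a * height ξ) • ξ‖ ^ 2 = sliceRadius a ξ ^ 2 := by
      rw [norm_sub_sq_real, norm_smul, inner_smul_right, real_inner_comm, hξ, h1, hrsq]
      have : inner ℝ ξ η = a * height ξ := by linarith
      rw [this]
      simp only [Real.norm_eq_abs, mul_one, sq_abs]
      ring
    have hnorm : ‖η - (a * height ξ) • ξ‖ = sliceRadius a ξ := by
      have := abs_eq_abs.2 (sq_eq_sq_iff_eq_or_eq_neg.1 hsq)
      rwa [abs_of_nonneg (norm_nonneg _), abs_of_pos hrp] at this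
    refine ⟨⟨⟨_, hmem⟩, ?_⟩, ?_⟩
    · rw [mem_sphere_zero_iff_norm, ← Submodule.norm_coe, norm_smul, hnorm, norm_inv,
        Real.norm_of_nonneg hrp.le, inv_mul_cancel₀ hrp.ne']
    · simp only [slicePoint]
      rw [smul_smul, mul_inv_cancel₀ hrp.ne', one_smul]
      abel

end SphericalSlice

end

open SphericalSlice

/-! For zonal f only the distribution of the height over the slice matters. Write s = ξ_{n+1}, w =
√(1-s²), R = √(1-a²s²). The hyperplane through A = (0,…,0,a) orthogonal to ξ cuts the sphere in an
(n-1)-sphere of radius R about asξ, on which the height is as² + Rwu, with u one coordinate of the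
unit sphere of ξ^⊥. Such a coordinate has density σ_{n-2}(1-u²)^{(n-3)/2}
(`lintegral_toSphere_inner`), so the height has an explicit density, and the condition η_{n+1} < a
only moves the upper end of its interval to a (`map_height_restrict_slice`). Thus S_a f, together
with its existence, becomes a one-dimensional integral in h.

The point π(x) lies on the ray from A through (x,-1), and the slicing hyperplane meets the height -1
in the hyperplane θ·x = t, where t = (a+1)s/w. Accordingly h = Q₀(r) carries (t,∞) onto the interval
of heights (`image_Q₀`), and Jacobian times density is the kernel of the one-variable V_a R U_a
(`deriv_mul_sliceDensity`). The n-dimensional form follows since U_a f is radial (`radon_radial`).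
For a = 0 and a = 1 the density itself simplifies to the Abel kernels.

Almost everywhere existence is Tonelli with the s-integral taken first: ∫ (A - s²B)₊^p ds scales to
a finite constant times √(A/B) A^p, which the weight dominates (`exists_le_mul_zonalWeight`). A null
set of heights pulls back to a null set of the sphere. -/

namespace SphericalSlice

open Module Metric

/-! ### Splitting a vector along a unit vector and its orthogonal complement. -/

section Orthogonal

variable {F : Type*} [NormedAddCommGroup F] [InnerProductSpace ℝ F]

theorem norm_smul_add_orthogonal {e : F} (he : ‖e‖ = 1) (h : ℝ) (y : (Submodule.span ℝ {e})ᗮ) :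
    ‖h • e + (y : F)‖ = √(h ^ 2 + ‖y‖ ^ 2) := by
  have hy : inner ℝ e (y : F) = 0 := Submodule.mem_orthogonal_singleton_iff_inner_right.1 y.2
  rw [eq_comm, Real.sqrt_eq_iff_mul_self_eq (by positivity) (norm_nonneg _), ← sq,
    norm_add_sq_real, norm_smul, inner_smul_left, hy, he, Submodule.norm_coe]
  simp

theorem inner_smul_add_orthogonal {e : F} (he : ‖e‖ = 1) (h : ℝ)
    (y : (Submodule.span ℝ {e})ᗮ) : inner ℝ e (h • e + (y : F)) = h := by
  have hy : inner ℝ e (y : F) = 0 := Submodule.mem_orthogonal_singleton_iff_inner_right.1 y.2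
  rw [inner_add_right, inner_smul_right, hy, real_inner_self_eq_norm_sq, he]
  simp

theorem finrank_orthogonal_span [FiniteDimensional ℝ F] {e : F} (he : ‖e‖ = 1) :
    finrank ℝ (Submodule.span ℝ {e})ᗮ = finrank ℝ F - 1 := by
  have h0 : e ≠ 0 := by rintro rfl; simp at he
  have h1 := (Submodule.span ℝ {e}).finrank_add_finrank_orthogonal
  rw [finrank_span_singleton h0] at h1
  omega

end Orthogonal

/-! ### Polar coordinates and the constants σ_k. -/

section Polar

variable {F : Type*} [NormedAddCommGroup F] [InnerProductSpace ℝ F] [FiniteDimensional ℝ F]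
  [MeasurableSpace F] [BorelSpace F]

/-- Integration in polar coordinates of a product of an angular and a radial function. -/
theorem lintegral_polar [Nontrivial F] {φ : F → ENNReal} (hφ : Measurable φ) {χ : ℝ → ENNReal}
    (hχ : Measurable χ) :
    ∫⁻ x : F, φ (‖x‖⁻¹ • x) * χ ‖x‖ =
      (∫⁻ ω, φ (ω : sphere (0 : F) 1) ∂(volume : Measure F).toSphere) *
        ∫⁻ k in Ioi (0 : ℝ), ENNReal.ofReal (k ^ (finrank ℝ F - 1)) * χ k := by
  have h1 := (volume : Measure F).measurePreserving_homeomorphUnitSphereProd.lintegral_comp_emb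
    (Homeomorph.measurableEmbedding _)
    (fun p : sphere (0 : F) 1 × Ioi (0 : ℝ) => φ p.1 * χ p.2)
  simp only [homeomorphUnitSphereProd_apply_fst_coe, homeomorphUnitSphereProd_apply_snd_coe] at h1
  rw [lintegral_subtype_comap (measurableSet_singleton (0 : F)).compl
    (fun x : F => φ (‖x‖⁻¹ • x) * χ ‖x‖), restrict_compl_singleton] at h1
  rw [h1, lintegral_prod_mul (f := fun ω : sphere (0 : F) 1 => φ ω)
    (g := fun k : Ioi (0 : ℝ) => χ k) (by fun_prop) (by fun_prop)]
  congr 1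
  rw [Measure.volumeIoiPow, lintegral_withDensity_eq_lintegral_mul _ (by fun_prop) (by fun_prop)]
  exact lintegral_subtype_comap measurableSet_Ioi
    (fun k : ℝ => ENNReal.ofReal (k ^ (finrank ℝ F - 1)) * χ k)

theorem sphereArea_pos (k : ℕ) : 0 < sphereArea k := by
  have : 0 < Real.Gamma (((k : ℝ) + 1) / 2) := Real.Gamma_pos_of_pos (by positivity)
  unfold sphereArea
  positivity

/-- `σ_k` is `k + 1` times the volume of the unit ball of a space of dimension `k + 1`. -/
theorem sphereArea_eq_dim_mul_ball [Nontrivial F] :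
    sphereArea (finrank ℝ F - 1) = finrank ℝ F * (volume : Measure F).real (ball 0 1) := by
  have hpos : 0 < finrank ℝ F := finrank_pos
  have hd : (0 : ℝ) < finrank ℝ F := by exact_mod_cast hpos
  have hc : ((finrank ℝ F - 1 : ℕ) : ℝ) + 1 = finrank ℝ F := by
    rw [Nat.cast_sub hpos]; simp
  have hG := Real.Gamma_pos_of_pos (half_pos hd)
  have hG' := Real.Gamma_add_one (half_pos hd).ne'
  have hpi : Real.pi ^ ((finrank ℝ F : ℝ) / 2) = √Real.pi ^ finrank ℝ F := by
    rw [Real.sqrt_eq_rpow, ← Real.rpow_natCast, ← Real.rpow_mul Real.pi_pos.le]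
    ring_nf
  rw [sphereArea, hc, Measure.real, InnerProductSpace.volume_ball, hG', hpi, ENNReal.ofReal_one,
    one_pow, one_mul, ENNReal.toReal_ofReal (by positivity)]
  field_simp

theorem toSphere_univ [Nontrivial F] :
    (volume : Measure F).toSphere univ = ENNReal.ofReal (sphereArea (finrank ℝ F - 1)) := by
  rw [sphereArea_eq_dim_mul_ball, ← nsmul_eq_mul, ← ofReal_measureReal (measure_ne_top _ _),
    Measure.toSphere_real_apply_univ, nsmul_eq_mul]

theorem lintegral_fun_norm [Nontrivial F] {χ : ℝ → ENNReal} (hχ : Measurable χ) :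
    ∫⁻ x : F, χ ‖x‖ = ENNReal.ofReal (sphereArea (finrank ℝ F - 1)) *
      ∫⁻ k in Ioi (0 : ℝ), ENNReal.ofReal (k ^ (finrank ℝ F - 1)) * χ k := by
  have := lintegral_polar (F := F) (φ := fun _ => 1) measurable_const hχ
  simpa [-Measure.toSphere_apply_univ, toSphere_univ] using this

/-- The orthogonal decomposition is an isometry and e identifies ℝ with its span, so Fubini applies
along e and e^⊥. -/
theorem volume_preserving_smul_add {e : F} (he : ‖e‖ = 1) :
    MeasurePreserving (fun p : ℝ × (Submodule.span ℝ {e})ᗮ => p.1 • e + (p.2 : F)) := by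
  have h1 := ((LinearIsometryEquiv.toSpanUnitSingleton (𝕜 := ℝ) e he).measurePreserving).prod
    (MeasurePreserving.id (volume : Measure (Submodule.span ℝ {e})ᗮ))
  have h2 := (WithLp.volume_preserving_toLp (Submodule.span ℝ {e}) (Submodule.span ℝ {e})ᗮ)
  have h3 := (Submodule.span ℝ {e}).orthogonalDecomposition.symm.measurePreserving
  convert! (h3.comp h2).comp h1 using 1

end Polar

/-! ### The distribution of one coordinate on the unit sphere. -/

theorem lintegral_Ioo_pi_cos (m : ℕ) (hm : 2 ≤ m) (φ : ℝ → ENNReal) :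
    ∫⁻ α in Ioo 0 Real.pi, ENNReal.ofReal (Real.sin α ^ (m - 2)) * φ (Real.cos α) =
      ∫⁻ u in Ioo (-1 : ℝ) 1, ENNReal.ofReal ((1 - u ^ 2) ^ (((m : ℝ) - 3) / 2)) * φ u := by
  have himg : Real.cos '' Ioo 0 Real.pi = Ioo (-1) 1 := by
    ext u
    constructor
    · rintro ⟨α, hα, rfl⟩
      have := Real.sin_pos_of_mem_Ioo hα
      have := Real.sin_sq_add_cos_sq α
      constructor <;> nlinarith
    · intro hu
      refine ⟨Real.arccos u, ⟨Real.arccos_pos.2 hu.2, Real.arccos_lt_pi.2 hu.1⟩,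
        Real.cos_arccos hu.1.le hu.2.le⟩
  rw [← himg, lintegral_image_eq_lintegral_abs_deriv_mul measurableSet_Ioo
    (fun x _ => (Real.hasDerivAt_cos x).hasDerivWithinAt)
    (Real.injOn_cos.mono Ioo_subset_Icc_self)]
  refine setLIntegral_congr_fun measurableSet_Ioo fun α hα => ?_
  have hs := Real.sin_pos_of_mem_Ioo hα
  have h1 : 1 - Real.cos α ^ 2 = Real.sin α ^ (2 : ℝ) := by
    rw [Real.rpow_two]; linarith [Real.sin_sq_add_cos_sq α]
  simp only [abs_neg, abs_of_pos hs]
  rw [← mul_assoc, ← ENNReal.ofReal_mul hs.le, h1, ← Real.rpow_mul hs.le]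
  congr 2
  nth_rewrite 2 [← Real.rpow_one (Real.sin α)]
  rw [← Real.rpow_add hs, ← Real.rpow_natCast]
  congr 1
  push_cast [Nat.cast_sub hm]
  ring

/-- The half-plane integral of a product of a radial and an angular function. -/
theorem lintegral_halfPlane (m : ℕ) (hm : 2 ≤ m) {φ χ : ℝ → ENNReal} (hφ : Measurable φ)
    (hχ : Measurable χ) :
    ∫⁻ h : ℝ, ∫⁻ k in Ioi (0 : ℝ), ENNReal.ofReal (k ^ (m - 2)) *
        (φ ((√(h ^ 2 + k ^ 2))⁻¹ * h) * χ √(h ^ 2 + k ^ 2)) =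
      (∫⁻ u in Ioo (-1 : ℝ) 1, ENNReal.ofReal ((1 - u ^ 2) ^ (((m : ℝ) - 3) / 2)) * φ u) *
        ∫⁻ r in Ioi (0 : ℝ), ENNReal.ofReal (r ^ (m - 1)) * χ r := by
  have h0 : ∀ h : ℝ, ∫⁻ k in Ioi (0 : ℝ), ENNReal.ofReal (k ^ (m - 2)) *
        (φ ((√(h ^ 2 + k ^ 2))⁻¹ * h) * χ √(h ^ 2 + k ^ 2)) =
      ∫⁻ k : ℝ, (fun p : ℝ × ℝ => (Ioi (0 : ℝ)).indicator
        (fun k => ENNReal.ofReal (k ^ (m - 2)) *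
        (φ ((√(p.1 ^ 2 + k ^ 2))⁻¹ * p.1) * χ √(p.1 ^ 2 + k ^ 2))) p.2) (h, k) := fun h => by
    rw [← lintegral_indicator measurableSet_Ioi]
  have hmeas : Measurable (fun p : ℝ × ℝ => (Ioi (0 : ℝ)).indicator
        (fun k => ENNReal.ofReal (k ^ (m - 2)) *
        (φ ((√(p.1 ^ 2 + k ^ 2))⁻¹ * p.1) * χ √(p.1 ^ 2 + k ^ 2))) p.2) := by
    have : (fun p : ℝ × ℝ => (Ioi (0 : ℝ)).indicator
        (fun k => ENNReal.ofReal (k ^ (m - 2)) *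
        (φ ((√(p.1 ^ 2 + k ^ 2))⁻¹ * p.1) * χ √(p.1 ^ 2 + k ^ 2))) p.2) =
      (Prod.snd ⁻¹' Ioi (0 : ℝ)).indicator (fun p : ℝ × ℝ => ENNReal.ofReal (p.2 ^ (m - 2)) *
        (φ ((√(p.1 ^ 2 + p.2 ^ 2))⁻¹ * p.1) * χ √(p.1 ^ 2 + p.2 ^ 2))) := rfl
    rw [this]
    exact Measurable.indicator (by fun_prop) (measurable_snd measurableSet_Ioi)
  simp_rw [h0]
  rw [← lintegral_prod _ hmeas.aemeasurable, ← Measure.volume_eq_prod,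
    ← lintegral_comp_polarCoord_symm]
  have h1 : ∀ p ∈ polarCoord.target, ENNReal.ofReal p.1 • (Ioi (0 : ℝ)).indicator
        (fun k => ENNReal.ofReal (k ^ (m - 2)) *
        (φ ((√((polarCoord.symm p).1 ^ 2 + k ^ 2))⁻¹ * (polarCoord.symm p).1) *
          χ √((polarCoord.symm p).1 ^ 2 + k ^ 2))) (polarCoord.symm p).2 =
      (ENNReal.ofReal (p.1 ^ (m - 1)) * χ p.1) *
        (Ioo 0 Real.pi).indicator
          (fun α => ENNReal.ofReal (Real.sin α ^ (m - 2)) * φ (Real.cos α)) p.2 := by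
    rintro ⟨r, α⟩ ⟨hr, hα⟩
    simp only [mem_Ioi] at hr
    simp only [mem_Ioo] at hα
    simp only [polarCoord_symm_apply]
    have hn : √((r * Real.cos α) ^ 2 + (r * Real.sin α) ^ 2) = r := by
      rw [mul_pow, mul_pow, ← mul_add, Real.cos_sq_add_sin_sq, mul_one, Real.sqrt_sq hr.le]
    -- Polar angles run over (-π, π); the half-plane k > 0 is the range (0, π), and the indicator
    -- kills the rest.
    by_cases h : α ∈ Ioo 0 Real.pi
    · have hs := Real.sin_pos_of_mem_Ioo h
      rw [indicator_of_mem (mem_Ioi.2 (mul_pos hr hs)), indicator_of_mem h, hn,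
        inv_mul_cancel_left₀ hr.ne', mul_pow, smul_eq_mul, ENNReal.ofReal_mul (by positivity),
        show m - 1 = (m - 2) + 1 by omega, pow_succ, ENNReal.ofReal_mul (by positivity)]
      ring
    · have hs : Real.sin α ≤ 0 := by
        have : α ≤ 0 := by
          by_contra hc
          exact h ⟨not_le.1 hc, hα.2⟩
        exact Real.sin_nonpos_of_nonpos_of_neg_pi_le this hα.1.le
      rw [indicator_of_notMem h, indicator_of_notMem, smul_zero, mul_zero]
      simp only [mem_Ioi, not_lt]
      exact mul_nonpos_of_nonneg_of_nonpos hr.le hs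
  rw [setLIntegral_congr_fun polarCoord.open_target.measurableSet h1, polarCoord_target,
    Measure.volume_eq_prod, ← Measure.prod_restrict,
    lintegral_prod_mul (f := fun r => ENNReal.ofReal (r ^ (m - 1)) * χ r)
      (g := (Ioo 0 Real.pi).indicator
        (fun α => ENNReal.ofReal (Real.sin α ^ (m - 2)) * φ (Real.cos α))) (by fun_prop)
      (Measurable.indicator (by fun_prop) measurableSet_Ioo).aemeasurable, mul_comm]
  congr 1
  rw [lintegral_indicator measurableSet_Ioo, Measure.restrict_restrict measurableSet_Ioo,
    inter_eq_self_of_subset_left, lintegral_Ioo_pi_cos m hm]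
  exact Ioo_subset_Ioo_left (by linarith [Real.pi_pos])

/-- The integral over the unit sphere of a function of one coordinate. -/
theorem lintegral_toSphere_inner {F : Type*} [NormedAddCommGroup F] [InnerProductSpace ℝ F]
    [FiniteDimensional ℝ F] [MeasurableSpace F] [BorelSpace F] {m : ℕ} (hm : 2 ≤ m)
    (hF : finrank ℝ F = m) {e : F} (he : ‖e‖ = 1) {φ : ℝ → ENNReal} (hφ : Measurable φ) :
    ∫⁻ ω : sphere (0 : F) 1, φ (inner ℝ e (ω : F)) ∂(volume : Measure F).toSphere =
      ENNReal.ofReal (sphereArea (m - 2)) *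
        ∫⁻ u in Ioo (-1 : ℝ) 1, ENNReal.ofReal ((1 - u ^ 2) ^ (((m : ℝ) - 3) / 2)) * φ u := by
  have : Nontrivial F := nontrivial_of_finrank_pos (R := ℝ) (by omega)
  have hK : finrank ℝ (Submodule.span ℝ {e})ᗮ = m - 1 := by rw [finrank_orthogonal_span he, hF]
  have : Nontrivial (Submodule.span ℝ {e})ᗮ := nontrivial_of_finrank_pos (R := ℝ) (by omega)
  -- The integral of φ(e·x/|x|) χ(|x|) over F is computed twice: in polar coordinates of F, and
  -- along e and e^⊥ with polar coordinates in the half-plane. Both contain the same radial factor,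
  -- which can be cancelled once it is neither 0 nor ∞; cutting off at the unit ball makes it 1/m.
  set χ : ℝ → ENNReal := (Iio 1).indicator 1
  have hχ : Measurable χ := measurable_one.indicator measurableSet_Iio
  have hI : ∫⁻ r in Ioi (0 : ℝ), ENNReal.ofReal (r ^ (m - 1)) * χ r =
      ENNReal.ofReal (1 / m) := by
    have h1 : ∀ r : ℝ, ENNReal.ofReal (r ^ (m - 1)) * χ r =
        (Iio 1).indicator (fun r => ENNReal.ofReal (r ^ (m - 1))) r := fun r => by
      by_cases hr : r ∈ Iio (1 : ℝ) <;> simp [χ, hr]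
    simp_rw [h1]
    rw [lintegral_indicator measurableSet_Iio, Measure.restrict_restrict measurableSet_Iio,
      inter_comm, Ioi_inter_Iio, restrict_Ioo_eq_restrict_Ioc,
      ← ofReal_integral_eq_lintegral_ofReal (intervalIntegral.intervalIntegrable_pow _).1,
      ← intervalIntegral.integral_of_le zero_le_one]
    · have : ((m - 1 : ℕ) : ℝ) + 1 = m := by rw [Nat.cast_sub (by omega)]; simp
      simp [this]
    · filter_upwards [ae_restrict_mem measurableSet_Ioc] with y hy
      exact pow_nonneg hy.1.le _
  have hI0 : ENNReal.ofReal (1 / m) ≠ 0 := by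
    have : (0 : ℝ) < m := by exact_mod_cast (by omega : 0 < m)
    rw [ENNReal.ofReal_ne_zero_iff]
    positivity
  have hA := lintegral_polar (F := F) (φ := fun x => φ (inner ℝ e x)) (by fun_prop) hχ
  have hmeas : Measurable (fun x : F => φ (inner ℝ e (‖x‖⁻¹ • x)) * χ ‖x‖) := by fun_prop
  rw [hF, hI, ← (volume_preserving_smul_add he).lintegral_comp hmeas,
    Measure.volume_eq_prod, lintegral_prod (fun p : ℝ × (Submodule.span ℝ {e})ᗮ =>
      φ (inner ℝ e (‖p.1 • e + (p.2 : F)‖⁻¹ • (p.1 • e + (p.2 : F)))) * χ ‖p.1 • e + (p.2 : F)‖)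
      (hmeas.comp (volume_preserving_smul_add he).measurable).aemeasurable] at hA
  simp only [inner_smul_right, norm_smul_add_orthogonal he, inner_smul_add_orthogonal he] at hA
  have hB : ∀ h : ℝ, ∫⁻ y : (Submodule.span ℝ {e})ᗮ,
      φ ((√(h ^ 2 + ‖y‖ ^ 2))⁻¹ * h) * χ √(h ^ 2 + ‖y‖ ^ 2) =
      ENNReal.ofReal (sphereArea (m - 2)) * ∫⁻ k in Ioi (0 : ℝ), ENNReal.ofReal (k ^ (m - 2)) *
        (φ ((√(h ^ 2 + k ^ 2))⁻¹ * h) * χ √(h ^ 2 + k ^ 2)) := fun h => by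
    rw [lintegral_fun_norm (F := (Submodule.span ℝ {e})ᗮ)
      (χ := fun k => φ ((√(h ^ 2 + k ^ 2))⁻¹ * h) * χ √(h ^ 2 + k ^ 2)) (by fun_prop), hK]
    rfl
  simp_rw [hB] at hA
  rw [lintegral_const_mul' _ _ ENNReal.ofReal_ne_top, lintegral_halfPlane m hm hφ hχ, hI,
    ← mul_assoc] at hA
  exact ((ENNReal.mul_left_inj hI0 ENNReal.ofReal_ne_top).1 hA).symm

/-! ### The density of the height on a slice and the ends of its support. -/

/-- The density of the distribution of the height on a slice at height `s`. -/
noncomputable def sliceDensity (n : ℕ) (a s h : ℝ) : ℝ :=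
  sphereArea (n - 2) * √((1 - a ^ 2 * s ^ 2) / (1 - s ^ 2)) *
    (((1 - h ^ 2) - s ^ 2 * (1 + a ^ 2 - 2 * a * h)) / (1 - s ^ 2)) ^ (((n : ℝ) - 3) / 2)

/-- The least height on a slice. -/
noncomputable def sliceBottom (a s : ℝ) : ℝ := a * s ^ 2 - √(1 - a ^ 2 * s ^ 2) * √(1 - s ^ 2)

/-- The greatest height on a full slice. -/
noncomputable def sliceTop (a s : ℝ) : ℝ := a * s ^ 2 + √(1 - a ^ 2 * s ^ 2) * √(1 - s ^ 2)

theorem one_sub_sq_pos {s : ℝ} (hs0 : 0 ≤ s) (hs1 : s < 1) : 0 < 1 - s ^ 2 := by nlinarith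

theorem one_sub_mul_sq_pos {a s : ℝ} (ha : -1 < a) (ha1 : a ≤ 1) (hs0 : 0 ≤ s) (hs1 : s < 1) :
    0 < 1 - a ^ 2 * s ^ 2 := by
  have h1 : a ^ 2 ≤ 1 := by nlinarith
  have h2 := one_sub_sq_pos hs0 hs1
  nlinarith [sq_nonneg s]

section

variable {a s : ℝ} (ha : -1 < a) (ha1 : a ≤ 1) (hs0 : 0 ≤ s) (hs1 : s < 1)
include ha ha1 hs0 hs1

/-- (1-a²s²)(1-s²) exceeds a²(1-s²)² by (1-s²)(1-a²) ≥ 0. Hence truncation at a replaces the upper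
end of the interval by a. -/
theorem le_sliceTop : a ≤ sliceTop a s := by
  have h1 := one_sub_sq_pos hs0 hs1
  have h2 := one_sub_mul_sq_pos ha ha1 hs0 hs1
  have h3 : a * (1 - s ^ 2) ≤ √(1 - a ^ 2 * s ^ 2) * √(1 - s ^ 2) := by
    rw [← Real.sqrt_mul h2.le]
    refine Real.le_sqrt_of_sq_le ?_
    have h4 : a ^ 2 ≤ 1 := by nlinarith
    nlinarith [mul_nonneg h1.le (sub_nonneg.2 h4)]
  unfold sliceTop
  linarith

/-- (1+as²)² - (1-a²s²)(1-s²) = s²(1+a)² ≥ 0. This keeps all heights on the slice within the domain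
of f₀. -/
theorem neg_one_le_sliceBottom : -1 ≤ sliceBottom a s := by
  have h1 := one_sub_sq_pos hs0 hs1
  have h2 := one_sub_mul_sq_pos ha ha1 hs0 hs1
  have h3 : √(1 - a ^ 2 * s ^ 2) * √(1 - s ^ 2) ≤ 1 + a * s ^ 2 := by
    rw [← Real.sqrt_mul h2.le]
    refine Real.sqrt_le_iff.2 ⟨by nlinarith [sq_nonneg s], ?_⟩
    nlinarith [mul_nonneg (sq_nonneg s) (sq_nonneg (1 + a))]
  unfold sliceBottom
  linarith

/-- Both sides are the difference of squares (Rw)² - (h - as²)². -/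
theorem sliceDensity_base (h : ℝ) :
    (1 - h ^ 2) - s ^ 2 * (1 + a ^ 2 - 2 * a * h) = (h - sliceBottom a s) * (sliceTop a s - h) := by
  have h1 := Real.sq_sqrt (one_sub_sq_pos hs0 hs1).le
  have h2 := Real.sq_sqrt (one_sub_mul_sq_pos ha ha1 hs0 hs1).le
  have : (h - sliceBottom a s) * (sliceTop a s - h) =
      √(1 - a ^ 2 * s ^ 2) ^ 2 * √(1 - s ^ 2) ^ 2 - (h - a * s ^ 2) ^ 2 := by
    unfold sliceBottom sliceTop; ring
  rw [this, h1, h2]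
  ring

theorem sliceDensity_base_pos {h : ℝ} (hh : h ∈ Ioo (sliceBottom a s) a) :
    0 < (1 - h ^ 2) - s ^ 2 * (1 + a ^ 2 - 2 * a * h) := by
  rw [sliceDensity_base ha ha1 hs0 hs1]
  exact mul_pos (sub_pos.2 hh.1) (sub_pos.2 (hh.2.trans_le (le_sliceTop ha ha1 hs0 hs1)))

theorem sliceDensity_pos (n : ℕ) {h : ℝ} (hh : h ∈ Ioo (sliceBottom a s) a) :
    0 < sliceDensity n a s h := by
  have h1 := one_sub_sq_pos hs0 hs1
  have h2 := one_sub_mul_sq_pos ha ha1 hs0 hs1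
  have h3 := sliceDensity_base_pos ha ha1 hs0 hs1 hh
  have := sphereArea_pos (n - 2)
  unfold sliceDensity
  positivity

end

theorem measurable_sliceDensity (n : ℕ) (a s : ℝ) : Measurable (sliceDensity n a s) := by
  unfold sliceDensity
  fun_prop

/-! ### The image of the slice measure under the height. -/

theorem finrank_E (k : ℕ) : finrank ℝ (E k) = k := by simp

theorem inner_single_last {n : ℕ} (x : E (n + 1)) :
    inner ℝ (EuclideanSpace.single (Fin.last n) (1 : ℝ)) x = height x := by
  simp [EuclideanSpace.inner_single_left, height]

theorem inner_single_last' {n : ℕ} (x : E (n + 1)) :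
    inner ℝ x (EuclideanSpace.single (Fin.last n) (1 : ℝ)) = height x := by
  rw [real_inner_comm, inner_single_last]

@[fun_prop]
theorem continuous_height {n : ℕ} : Continuous (height : E (n + 1) → ℝ) := by
  unfold height
  fun_prop

@[fun_prop]
theorem measurable_height {n : ℕ} : Measurable (height : E (n + 1) → ℝ) :=
  continuous_height.measurable

theorem measurable_slicePoint {n : ℕ} (a : ℝ) (ξ : E (n + 1)) : Measurable (slicePoint a ξ) := by
  have : Continuous (slicePoint a ξ) := by
    unfold slicePoint
    fun_prop
  exact this.measurable

/-- The height on a slice is an affine function of one coordinate of the parameter. -/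
theorem exists_height_slicePoint {n : ℕ} (a : ℝ) {ξ : E (n + 1)} (hξ : ‖ξ‖ = 1)
    (hs0 : 0 ≤ height ξ) (hs1 : height ξ < 1) :
    ∃ e : (Submodule.span ℝ {ξ})ᗮ, ‖e‖ = 1 ∧ ∀ ω, height (slicePoint a ξ ω) =
      a * height ξ ^ 2 + √(1 - a ^ 2 * height ξ ^ 2) * √(1 - height ξ ^ 2) *
        inner ℝ e (ω : (Submodule.span ℝ {ξ})ᗮ) := by
  have hw := one_sub_sq_pos hs0 hs1
  have hw' := Real.sqrt_pos.2 hw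
  -- The projection of e_{n+1} to ξ^⊥, of length √(1-s²); normalized, it is the coordinate that
  -- determines the height.
  set v : E (n + 1) := EuclideanSpace.single (Fin.last n) (1 : ℝ) - height ξ • ξ with hv
  have hmem : (√(1 - height ξ ^ 2))⁻¹ • v ∈ (Submodule.span ℝ {ξ})ᗮ := by
    rw [Submodule.mem_orthogonal_singleton_iff_inner_right, inner_smul_right, hv, inner_sub_right,
      inner_smul_right, inner_single_last', real_inner_self_eq_norm_sq, hξ]
    simp
  have hnv : ‖v‖ = √(1 - height ξ ^ 2) := by
    rw [eq_comm, Real.sqrt_eq_iff_mul_self_eq hw.le (norm_nonneg _), ← sq, hv, norm_sub_sq_real,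
      inner_smul_right, inner_single_last, norm_smul, hξ]
    simp
    ring
  refine ⟨⟨_, hmem⟩, ?_, fun ω => ?_⟩
  · rw [← Submodule.norm_coe, norm_smul, hnv, norm_inv, Real.norm_of_nonneg hw'.le,
      inv_mul_cancel₀ hw'.ne']
  · have hω : inner ℝ ξ ((ω : (Submodule.span ℝ {ξ})ᗮ) : E (n + 1)) = 0 :=
      Submodule.mem_orthogonal_singleton_iff_inner_right.1 ω.1.2
    rw [Submodule.coe_inner, inner_smul_left, hv, inner_sub_left, inner_smul_left, hω,
      inner_single_last]
    simp only [slicePoint, height, sliceRadius, PiLp.add_apply, PiLp.smul_apply, smul_eq_mul]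
    simp
    rw [height] at hw'
    field_simp

section

variable {a s : ℝ} (ha : -1 < a) (ha1 : a ≤ 1) (hs0 : 0 ≤ s) (hs1 : s < 1)
include ha ha1 hs0 hs1

theorem image_affine_Ioo :
    (fun u => a * s ^ 2 + √(1 - a ^ 2 * s ^ 2) * √(1 - s ^ 2) * u) '' Ioo (-1) 1 =
      Ioo (sliceBottom a s) (sliceTop a s) := by
  have hd : 0 < √(1 - a ^ 2 * s ^ 2) * √(1 - s ^ 2) :=
    mul_pos (Real.sqrt_pos.2 (one_sub_mul_sq_pos ha ha1 hs0 hs1))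
      (Real.sqrt_pos.2 (one_sub_sq_pos hs0 hs1))
  simp_rw [add_comm (a * s ^ 2)]
  rw [Set.image_affine_Ioo hd]
  congr 1
  · unfold sliceBottom; ring
  · unfold sliceTop; ring

/-- At h = as² + Rwu the base of the power is R²(1-u²). The Jacobian Rw, the factor R/w and R^{n-3}
combine to R^{n-1}, the scaling of surface measure. -/
theorem sliceDensity_affine {n : ℕ} (hn : 2 ≤ n) {u : ℝ} (hu : u ∈ Ioo (-1 : ℝ) 1) :
    √(1 - a ^ 2 * s ^ 2) * √(1 - s ^ 2) * sliceDensity n a s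
        (a * s ^ 2 + √(1 - a ^ 2 * s ^ 2) * √(1 - s ^ 2) * u) =
      √(1 - a ^ 2 * s ^ 2) ^ (n - 1) *
        (sphereArea (n - 2) * (1 - u ^ 2) ^ (((n : ℝ) - 3) / 2)) := by
  have hw := one_sub_sq_pos hs0 hs1
  have hR := one_sub_mul_sq_pos ha ha1 hs0 hs1
  have hw' := Real.sqrt_pos.2 hw
  have hR' := Real.sqrt_pos.2 hR
  have hu2 : 0 < 1 - u ^ 2 := by nlinarith [hu.1, hu.2]
  have hwsq := Real.sq_sqrt hw.le
  have hRsq := Real.sq_sqrt hR.le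
  rw [sliceDensity, sliceDensity_base ha ha1 hs0 hs1, sliceBottom, sliceTop,
    Real.sqrt_div hR.le]
  generalize √(1 - a ^ 2 * s ^ 2) = R at *
  generalize √(1 - s ^ 2) = w at *
  rw [← hwsq]
  have h1 : (a * s ^ 2 + R * w * u - (a * s ^ 2 - R * w)) *
      (a * s ^ 2 + R * w - (a * s ^ 2 + R * w * u)) / w ^ 2 = R ^ (2 : ℝ) * (1 - u ^ 2) := by
    rw [Real.rpow_two]
    field_simp
    ring
  have h2 : R ^ (n - 1) = R ^ 2 * R ^ ((n : ℝ) - 3) := by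
    rw [← Real.rpow_natCast, ← Real.rpow_natCast, ← Real.rpow_add hR']
    congr 1
    push_cast [Nat.cast_sub (by omega : 1 ≤ n)]
    ring
  rw [h1, h2, Real.mul_rpow (by positivity) hu2.le, ← Real.rpow_mul hR'.le,
    mul_div_cancel₀ ((n : ℝ) - 3) two_ne_zero]
  field_simp

end

variable {n : ℕ} {a : ℝ} {ξ : E (n + 1)}

theorem lintegral_sliceMeasure (hn : 2 ≤ n) (ha : -1 < a) (ha1 : a ≤ 1) (hξ : ‖ξ‖ = 1)
    (hs0 : 0 ≤ height ξ) (hs1 : height ξ < 1) {φ : ℝ → ENNReal} (hφ : Measurable φ) :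
    ∫⁻ η, φ (height η) ∂sliceMeasure a ξ =
      ∫⁻ h in Ioo (sliceBottom a (height ξ)) (sliceTop a (height ξ)),
        ENNReal.ofReal (sliceDensity n a (height ξ) h) * φ h := by
  obtain ⟨e, he, hh⟩ := exists_height_slicePoint a hξ hs0 hs1
  have hfin : finrank ℝ (Submodule.span ℝ {ξ})ᗮ = n := by
    rw [finrank_orthogonal_span hξ, finrank_E]; rfl
  have hd : 0 < √(1 - a ^ 2 * height ξ ^ 2) * √(1 - height ξ ^ 2) :=
    mul_pos (Real.sqrt_pos.2 (one_sub_mul_sq_pos ha ha1 hs0 hs1))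
      (Real.sqrt_pos.2 (one_sub_sq_pos hs0 hs1))
  rw [sliceMeasure, lintegral_smul_measure, lintegral_map (by fun_prop)
    (measurable_slicePoint a ξ)]
  simp_rw [hh]
  rw [lintegral_toSphere_inner hn hfin he (φ := fun u => φ (a * height ξ ^ 2 +
      √(1 - a ^ 2 * height ξ ^ 2) * √(1 - height ξ ^ 2) * u)) (by fun_prop),
    ← image_affine_Ioo ha ha1 hs0 hs1,
    lintegral_image_eq_lintegral_abs_deriv_mul measurableSet_Ioo
      (f' := fun _ => √(1 - a ^ 2 * height ξ ^ 2) * √(1 - height ξ ^ 2)), smul_eq_mul, ← mul_assoc,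
    ← ENNReal.ofReal_mul (by unfold sliceRadius; positivity),
    ← lintegral_const_mul' _ _ ENNReal.ofReal_ne_top]
  · refine setLIntegral_congr_fun measurableSet_Ioo fun u hu => ?_
    rw [abs_of_pos hd, ← mul_assoc, ← mul_assoc, ← ENNReal.ofReal_mul hd.le,
      sliceDensity_affine ha ha1 hs0 hs1 hn hu, ← ENNReal.ofReal_mul, sliceRadius, mul_assoc]
    unfold sliceRadius
    have := sphereArea_pos (n - 2)
    positivity
  · intro u _
    simpa using (((hasDerivAt_id u).const_mul
      (√(1 - a ^ 2 * height ξ ^ 2) * √(1 - height ξ ^ 2))).const_add (a * height ξ ^ 2)).hasDerivWithinAt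
  · intro u _ v _ huv
    simpa [hd.ne'] using huv

theorem map_height_sliceMeasure (hn : 2 ≤ n) (ha : -1 < a) (ha1 : a ≤ 1) (hξ : ‖ξ‖ = 1)
    (hs0 : 0 ≤ height ξ) (hs1 : height ξ < 1) :
    (sliceMeasure a ξ).map height =
      (volume.restrict (Ioo (sliceBottom a (height ξ)) (sliceTop a (height ξ)))).withDensity
        (fun h => ENNReal.ofReal (sliceDensity n a (height ξ) h)) := by
  refine Measure.ext_of_lintegral _ fun φ hφ => ?_
  rw [lintegral_map hφ measurable_height, lintegral_sliceMeasure hn ha ha1 hξ hs0 hs1 hφ,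
    lintegral_withDensity_eq_lintegral_mul _ (measurable_sliceDensity _ _ _).ennreal_ofReal hφ]
  rfl

theorem measurableSet_slice : MeasurableSet (slice a ξ) := by
  have h1 : MeasurableSet {η : E (n + 1) | ‖η‖ = 1} :=
    (isClosed_eq continuous_norm continuous_const).measurableSet
  have h2 : MeasurableSet {η : E (n + 1) | height η < a} := measurable_height measurableSet_Iio
  have h3 : MeasurableSet {η : E (n + 1) | inner ℝ ξ (η - center n a) = 0} :=
    (isClosed_eq (by fun_prop) continuous_const).measurableSet
  exact (h1.inter h2).inter h3

/-- The measure is carried by the full slice, so of the conditions defining the slice only the bound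
on the height remains. -/
theorem restrict_slice (hξ : ‖ξ‖ = 1) (hr : a ^ 2 * height ξ ^ 2 < 1) :
    (sliceMeasure a ξ).restrict (slice a ξ) =
      (sliceMeasure a ξ).restrict (height ⁻¹' Iio a) := by
  refine Measure.restrict_congr_set ?_
  have h1 : ∀ᵐ η ∂sliceMeasure a ξ, η ∈ fullSlice a ξ := by
    refine Measure.ae_smul_measure ?_ _
    have hm : MeasurableSet (fullSlice a ξ) :=
      ((isClosed_eq continuous_norm continuous_const).inter
        (isClosed_eq (by fun_prop) continuous_const)).measurableSet
    refine (ae_map_iff (measurable_slicePoint a ξ).aemeasurable hm).2 (ae_of_all _ fun ω => ?_)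
    exact (range_slicePoint a ξ hξ hr).subset (mem_range_self ω)
  filter_upwards [h1] with η hη
  exact propext ⟨fun h => h.1.2, fun h => ⟨⟨hη.1, h⟩, hη.2⟩⟩

theorem map_height_restrict_slice (hn : 2 ≤ n) (ha : -1 < a) (ha1 : a ≤ 1) (hξ : ‖ξ‖ = 1)
    (hs0 : 0 ≤ height ξ) (hs1 : height ξ < 1) :
    ((sliceMeasure a ξ).restrict (slice a ξ)).map height =
      (volume.restrict (Ioo (sliceBottom a (height ξ)) a)).withDensity
        (fun h => ENNReal.ofReal (sliceDensity n a (height ξ) h)) := by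
  have hr := one_sub_mul_sq_pos ha ha1 hs0 hs1
  rw [restrict_slice hξ (by linarith), ← Measure.restrict_map measurable_height measurableSet_Iio,
    map_height_sliceMeasure hn ha ha1 hξ hs0 hs1, restrict_withDensity measurableSet_Iio,
    Measure.restrict_restrict measurableSet_Iio, inter_comm, Ioo_inter_Iio,
    min_eq_right (le_sliceTop ha ha1 hs0 hs1)]

/-! ### The slice transform of a zonal function as a one-dimensional integral. -/

variable {f₀ : ℝ → ℂ} {f : E (n + 1) → ℂ}

theorem sliceIntegrable_iff (hn : 2 ≤ n) (ha : -1 < a) (ha1 : a ≤ 1)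
    (hf₀ : AEStronglyMeasurable f₀ (volume.restrict (Ioo (-1) a)))
    (hf : ∀ η ∈ truncatedSphere n a, f η = f₀ (height η)) (hξ : ‖ξ‖ = 1)
    (hs0 : 0 ≤ height ξ) (hs1 : height ξ < 1) :
    SliceIntegrable a f ξ ↔ IntegrableOn (fun h => sliceDensity n a (height ξ) h • f₀ h)
      (Ioo (sliceBottom a (height ξ)) a) := by
  have hae : AEStronglyMeasurable f₀
      (((sliceMeasure a ξ).restrict (slice a ξ)).map height) := by
    rw [map_height_restrict_slice hn ha ha1 hξ hs0 hs1]
    -- Measurability of f₀ modulo Lebesgue null sets suffices, because the image measure has a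
    -- density on a subinterval of (-1, a).
    refine (hf₀.mono_measure ?_).mono_ac (withDensity_absolutelyContinuous _ _)
    exact Measure.restrict_mono_set _ (Ioo_subset_Ioo_left
      (neg_one_le_sliceBottom ha ha1 hs0 hs1))
  rw [SliceIntegrable, integrableOn_congr_fun (fun η hη => hf η hη.1) measurableSet_slice,
    IntegrableOn]
  refine (integrable_map_measure hae measurable_height.aemeasurable).symm.trans ?_
  rw [map_height_restrict_slice hn ha ha1 hξ hs0 hs1, integrable_withDensity_iff_integrable_smul'
    (measurable_sliceDensity _ _ _).ennreal_ofReal (ae_of_all _ fun _ => ENNReal.ofReal_lt_top)]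
  refine integrableOn_congr_fun (fun h hh => ?_) measurableSet_Ioo
  rw [ENNReal.toReal_ofReal (sliceDensity_pos ha ha1 hs0 hs1 n hh).le]

theorem sliceTransform_eq (hn : 2 ≤ n) (ha : -1 < a) (ha1 : a ≤ 1)
    (hf₀ : AEStronglyMeasurable f₀ (volume.restrict (Ioo (-1) a)))
    (hf : ∀ η ∈ truncatedSphere n a, f η = f₀ (height η)) (hξ : ‖ξ‖ = 1)
    (hs0 : 0 ≤ height ξ) (hs1 : height ξ < 1) :
    sliceTransform a f ξ = ∫ h in Ioo (sliceBottom a (height ξ)) a,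
      sliceDensity n a (height ξ) h • f₀ h := by
  have hae : AEStronglyMeasurable f₀
      (((sliceMeasure a ξ).restrict (slice a ξ)).map height) := by
    rw [map_height_restrict_slice hn ha ha1 hξ hs0 hs1]
    refine (hf₀.mono_measure ?_).mono_ac (withDensity_absolutelyContinuous _ _)
    exact Measure.restrict_mono_set _ (Ioo_subset_Ioo_left
      (neg_one_le_sliceBottom ha ha1 hs0 hs1))
  rw [sliceTransform, setIntegral_congr_fun measurableSet_slice (fun η hη => hf η hη.1),
    ← integral_map measurable_height.aemeasurable hae,
    map_height_restrict_slice hn ha ha1 hξ hs0 hs1, integral_withDensity_eq_integral_toReal_smul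
    (measurable_sliceDensity _ _ _).ennreal_ofReal (ae_of_all _ fun _ => ENNReal.ofReal_lt_top)]
  refine setIntegral_congr_fun measurableSet_Ioo (fun h hh => ?_)
  rw [ENNReal.toReal_ofReal (sliceDensity_pos ha ha1 hs0 hs1 n hh).le]

/-! ### The stereographic projection with pole A and the substitution h = Q₀(r). -/

theorem P₀_den_pos {a : ℝ} (ha : -1 < a) (r : ℝ) : 0 < r ^ 2 + (a + 1) ^ 2 := by
  have : 0 < a + 1 := by linarith
  positivity

theorem radonOffset_nonneg {a s : ℝ} (ha : -1 < a) (hs0 : 0 ≤ s) : 0 ≤ radonOffset a s := by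
  have : 0 ≤ a + 1 := by linarith
  unfold radonOffset
  positivity

theorem radonOffset_sq {s : ℝ} (a : ℝ) (hs0 : 0 ≤ s) (hs1 : s < 1) :
    radonOffset a s ^ 2 = (a + 1) ^ 2 * s ^ 2 / (1 - s ^ 2) := by
  rw [radonOffset, div_pow, mul_pow, Real.sq_sqrt (one_sub_sq_pos hs0 hs1).le]

/-- Geometrically, π(x) = A + P₀((x,-1) - A): the image lies on the line from A through (x,-1). -/
theorem Q₀_eq {a : ℝ} (ha : -1 < a) (r : ℝ) : Q₀ a r = a - (a + 1) * P₀ a r := by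
  have := P₀_den_pos ha r
  unfold P₀ Q₀
  field_simp
  ring

/-- Only the line equation h1 and the sphere equation h2 enter, so it serves both for p = P₀(r) and
for a p constructed from h. -/
theorem sliceDensity_base_of_eq {a s h p r : ℝ} (hs0 : 0 ≤ s) (hs1 : s < 1)
    (h1 : h = a - (a + 1) * p)
    (h2 : h ^ 2 + p ^ 2 * r ^ 2 = 1) :
    ((1 - h ^ 2) - s ^ 2 * (1 + a ^ 2 - 2 * a * h)) / (1 - s ^ 2) =
      p ^ 2 * (r ^ 2 - radonOffset a s ^ 2) := by
  have hw := one_sub_sq_pos hs0 hs1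
  rw [radonOffset_sq a hs0 hs1]
  field_simp
  have h3 : (a + 1) ^ 2 * p ^ 2 = (a - h) ^ 2 := by rw [h1]; ring
  linear_combination (s ^ 2) * h3 - (1 - s ^ 2) * h2

section

variable {a : ℝ} (ha : -1 < a) (ha1 : a ≤ 1)
include ha ha1

theorem D₀_arg_pos (r : ℝ) : 0 < r ^ 2 * (1 - a) + a + 1 := by
  nlinarith [mul_nonneg (sq_nonneg r) (sub_nonneg.2 ha1)]

theorem D₀_sq (r : ℝ) : D₀ a r ^ 2 = (a + 1) * (r ^ 2 * (1 - a) + a + 1) := by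
  rw [D₀, mul_pow, Real.sq_sqrt (by linarith), Real.sq_sqrt (D₀_arg_pos ha ha1 r).le]

theorem D₀_pos (r : ℝ) : 0 < D₀ a r :=
  mul_pos (Real.sqrt_pos.2 (by linarith)) (Real.sqrt_pos.2 (D₀_arg_pos ha ha1 r))

/-- Makes the numerator of P₀ at least (a+1)² > 0, also for negative a. -/
theorem le_D₀ (r : ℝ) : a + 1 ≤ D₀ a r := by
  refine le_of_sq_le_sq ?_ (D₀_pos ha ha1 r).le
  rw [D₀_sq ha ha1]
  nlinarith [mul_nonneg (mul_nonneg (sq_nonneg r) (sub_nonneg.2 ha1)) (by linarith : 0 ≤ a + 1)]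

theorem P₀_pos (r : ℝ) : 0 < P₀ a r := by
  refine div_pos ?_ (P₀_den_pos ha r)
  nlinarith [le_D₀ ha ha1 r]

theorem Q₀_lt (r : ℝ) : Q₀ a r < a := by
  rw [Q₀_eq ha]
  have := mul_pos (by linarith : 0 < a + 1) (P₀_pos ha ha1 r)
  linarith

theorem P₀_quadratic (r : ℝ) :
    P₀ a r * (P₀ a r * (r ^ 2 + (a + 1) ^ 2) - 2 * a * (a + 1)) = 1 - a ^ 2 := by
  have hN := P₀_den_pos ha r
  have hP : P₀ a r * (r ^ 2 + (a + 1) ^ 2) = a * (a + 1) + D₀ a r := by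
    unfold P₀; field_simp
  refine mul_right_cancel₀ hN.ne' ?_
  linear_combination (P₀ a r * (r ^ 2 + (a + 1) ^ 2) - 2 * a * (a + 1)) * hP +
    (a * (a + 1) + D₀ a r) * hP + D₀_sq ha ha1 r

theorem Q₀_sq_add (r : ℝ) : Q₀ a r ^ 2 + P₀ a r ^ 2 * r ^ 2 = 1 := by
  rw [Q₀_eq ha]
  linear_combination P₀_quadratic ha ha1 r

/-- `P₀(r)` is the positive solution of its quadratic equation. -/
theorem P₀_unique {r p : ℝ} (hp : 0 < p)
    (h : p * (p * (r ^ 2 + (a + 1) ^ 2) - 2 * a * (a + 1)) = 1 - a ^ 2) : P₀ a r = p := by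
  have hN := P₀_den_pos ha r
  have hD : D₀ a r = p * (r ^ 2 + (a + 1) ^ 2) - a * (a + 1) := by
    -- By the quadratic, the square of this quantity is D₀²; its sign selects the root with +D₀. For
    -- a > 0 the sign comes from the equation itself, whose right side 1 - a² is nonnegative.
    have h1 : 0 ≤ p * (r ^ 2 + (a + 1) ^ 2) - a * (a + 1) := by
      rcases le_or_gt a 0 with h0 | h0
      · nlinarith [mul_pos hp hN]
      · have h2 : 0 ≤ p * (r ^ 2 + (a + 1) ^ 2) - 2 * a * (a + 1) := by
          refine nonneg_of_mul_nonneg_right ?_ hp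
          rw [h]
          nlinarith
        nlinarith
    refine (pow_left_inj₀ (D₀_pos ha ha1 r).le h1 two_ne_zero).1 ?_
    rw [D₀_sq ha ha1]
    linear_combination -(r ^ 2 + (a + 1) ^ 2) * h
  rw [P₀, hD]
  field_simp
  ring

theorem hasDerivAt_Q₀ (r : ℝ) :
    HasDerivAt (Q₀ a) ((a + 1) * P₀ a r ^ 2 * r / D₀ a r) r := by
  have hN := P₀_den_pos ha r
  have hD := D₀_pos ha ha1 r
  have hS := Real.sqrt_pos.2 (D₀_arg_pos ha ha1 r)
  have h0 : HasDerivAt (fun r : ℝ => r ^ 2 * (1 - a) + a + 1) (2 * r * (1 - a)) r := by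
    simpa using (((hasDerivAt_pow 2 r).mul_const (1 - a)).add_const a).add_const 1
  have h1 : HasDerivAt (D₀ a) (√(a + 1) * (2 * r * (1 - a) /
      (2 * √(r ^ 2 * (1 - a) + a + 1)))) r :=
    (h0.sqrt (D₀_arg_pos ha ha1 r).ne').const_mul _
  have h2 : √(a + 1) * (2 * r * (1 - a) / (2 * √(r ^ 2 * (1 - a) + a + 1))) =
      (a + 1) * r * (1 - a) / D₀ a r := by
    have hs : 0 < √(a + 1) := Real.sqrt_pos.2 (by linarith)
    have hsq := Real.sq_sqrt (by linarith : 0 ≤ a + 1)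
    rw [D₀]
    generalize √(a + 1) = q at *
    rw [← hsq]
    field_simp
  rw [h2] at h1
  have h3 : HasDerivAt (fun r : ℝ => r ^ 2 + (a + 1) ^ 2) (2 * r) r := by
    simpa using (hasDerivAt_pow 2 r).add_const ((a + 1) ^ 2)
  have h4 : HasDerivAt (P₀ a) (((a + 1) * r * (1 - a) / D₀ a r * (r ^ 2 + (a + 1) ^ 2) -
      (a * (a + 1) + D₀ a r) * (2 * r)) / (r ^ 2 + (a + 1) ^ 2) ^ 2) r :=
    (h1.const_add (a * (a + 1))).div h3 hN.ne'
  have h5 : Q₀ a = fun r => a - (a + 1) * P₀ a r := funext (Q₀_eq ha)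
  rw [h5]
  convert! (h4.const_mul (a + 1)).const_sub a using 1
  rw [P₀]
  have hsq := D₀_sq ha ha1 r
  generalize D₀ a r = D at *
  field_simp
  linear_combination (-r * (a + 1)) * hsq

variable {s : ℝ} (hs0 : 0 ≤ s) (hs1 : s < 1)
include hs0 hs1

theorem image_Q₀ : Q₀ a '' Ioi (radonOffset a s) = Ioo (sliceBottom a s) a := by
  have hw := one_sub_sq_pos hs0 hs1
  have ht := radonOffset_nonneg ha hs0
  have ha0 : 0 < a + 1 := by linarith
  ext h
  constructor
  · rintro ⟨r, hr, rfl⟩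
    have hlt := Q₀_lt ha ha1 r
    refine ⟨?_, hlt⟩
    have hb := sliceDensity_base_of_eq hs0 hs1 (Q₀_eq ha r) (Q₀_sq_add ha ha1 r)
    have hr2 : 0 < r ^ 2 - radonOffset a s ^ 2 := by
      have : radonOffset a s < r := hr
      nlinarith
    rw [sliceDensity_base ha ha1 hs0 hs1, div_eq_iff hw.ne'] at hb
    have hpos : 0 < (Q₀ a r - sliceBottom a s) * (sliceTop a s - Q₀ a r) := by
      have := P₀_pos ha ha1 r
      rw [hb]
      positivity
    have := pos_of_mul_pos_left hpos (sub_nonneg.2 (hlt.le.trans (le_sliceTop ha ha1 hs0 hs1)))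
    linarith
  · intro hh
    have hb1 := neg_one_le_sliceBottom ha ha1 hs0 hs1
    have hbase := sliceDensity_base_pos ha ha1 hs0 hs1 hh
    -- The preimage is forced: the line equation gives p = (a-h)/(a+1), then the sphere equation
    -- gives r = √(1-h²)/p.
    have hp : 0 < (a - h) / (a + 1) := div_pos (sub_pos.2 hh.2) ha0
    set p := (a - h) / (a + 1) with hpdef
    have h1 : h = a - (a + 1) * p := by rw [hpdef]; field_simp; ring
    clear_value p
    have hh1 : 0 ≤ 1 - h ^ 2 := by
      have := hh.1; have := hh.2
      nlinarith
    have h2 : h ^ 2 + p ^ 2 * (√(1 - h ^ 2) / p) ^ 2 = 1 := by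
      rw [div_pow, Real.sq_sqrt hh1]
      field_simp
      ring
    have hb := sliceDensity_base_of_eq hs0 hs1 h1 h2
    have hr : radonOffset a s < √(1 - h ^ 2) / p := by
      have h3 : 0 < p ^ 2 * ((√(1 - h ^ 2) / p) ^ 2 - radonOffset a s ^ 2) :=
        hb ▸ div_pos hbase hw
      have h4 := pos_of_mul_pos_right h3 (sq_nonneg p)
      refine lt_of_pow_lt_pow_left₀ 2 (by positivity) (by linarith)
    refine ⟨√(1 - h ^ 2) / p, hr, ?_⟩
    have hP : P₀ a (√(1 - h ^ 2) / p) = p := by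
      refine P₀_unique ha ha1 hp ?_
      rw [h1] at h2
      rw [h1]
      linear_combination h2
    rw [Q₀_eq ha, hP, ← h1]

omit hs1 in
-- Equal heights give equal P₀ by the line equation, then equal r² by the sphere equation.
theorem injOn_Q₀ : InjOn (Q₀ a) (Ioi (radonOffset a s)) := by
  intro r hr q hq h
  have ht := radonOffset_nonneg ha hs0
  have hr0 : 0 < r := ht.trans_lt hr
  have hq0 : 0 < q := ht.trans_lt hq
  have hP : P₀ a r = P₀ a q := by
    have h1 := Q₀_eq ha r
    have h2 := Q₀_eq ha q
    have h3 : (a + 1) * P₀ a r = (a + 1) * P₀ a q := by linarith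
    exact mul_left_cancel₀ (by linarith : a + 1 ≠ 0) h3
  have h1 := Q₀_sq_add ha ha1 r
  have h2 := Q₀_sq_add ha ha1 q
  rw [h, hP] at h1
  have h3 : P₀ a q ^ 2 * r ^ 2 = P₀ a q ^ 2 * q ^ 2 := by linarith
  have h4 := mul_left_cancel₀ (pow_pos (P₀_pos ha ha1 q) 2).ne' h3
  exact (pow_left_inj₀ hr0.le hq0.le two_ne_zero).1 h4

/-- The base of the density becomes P₀²(r²-t²); its power P₀^{n-3} and the P₀² of the Jacobian make
the P₀^{n-1} in U_a. This explains the weights of U_a and V_a. -/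
theorem deriv_mul_sliceDensity {n : ℕ} (hn : 2 ≤ n) {r : ℝ} (hr : radonOffset a s < r) :
    |(a + 1) * P₀ a r ^ 2 * r / D₀ a r| * sliceDensity n a s (Q₀ a r) =
      √((1 - a ^ 2 * s ^ 2) / (1 - s ^ 2)) * sphereArea (n - 2) *
        ((r ^ 2 - radonOffset a s ^ 2) ^ (((n : ℝ) - 3) / 2) * r *
          ((a + 1) * P₀ a r ^ (n - 1) / D₀ a r)) := by
  have ht := radonOffset_nonneg ha hs0
  have ha0 : 0 < a + 1 := by linarith
  have hr0 : 0 < r := ht.trans_lt hr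
  have hP := P₀_pos ha ha1 r
  have hD := D₀_pos ha ha1 r
  have hr2 : 0 ≤ r ^ 2 - radonOffset a s ^ 2 := by nlinarith
  rw [abs_of_pos (by positivity), sliceDensity,
    sliceDensity_base_of_eq hs0 hs1 (Q₀_eq ha r) (Q₀_sq_add ha ha1 r),
    Real.mul_rpow (by positivity) hr2, ← Real.rpow_natCast (P₀ a r) 2, ← Real.rpow_mul hP.le]
  have h2 : P₀ a r ^ (n - 1) = P₀ a r ^ ((2 : ℕ) : ℝ) *
      P₀ a r ^ (((2 : ℕ) : ℝ) * (((n : ℝ) - 3) / 2)) := by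
    rw [← Real.rpow_natCast, ← Real.rpow_add hP]
    congr 1
    push_cast [Nat.cast_sub (by omega : 1 ≤ n)]
    ring
  rw [h2]
  ring

theorem integrableOn_sliceDensity_iff {n : ℕ} (hn : 2 ≤ n) (f₀ : ℝ → ℂ) :
    IntegrableOn (fun h => sliceDensity n a s h • f₀ h) (Ioo (sliceBottom a s) a) ↔
      IntegrableOn (radonIntegrand₀ n (opU₀ n a f₀) (radonOffset a s))
        (Ioi (radonOffset a s)) := by
  rw [← image_Q₀ ha ha1 hs0 hs1, integrableOn_image_iff_integrableOn_abs_deriv_smul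
    measurableSet_Ioi (fun r _ => (hasDerivAt_Q₀ ha ha1 r).hasDerivWithinAt)
    (injOn_Q₀ ha ha1 hs0)]
  have hc : √((1 - a ^ 2 * s ^ 2) / (1 - s ^ 2)) * sphereArea (n - 2) ≠ 0 :=
    (mul_pos (Real.sqrt_pos.2 (div_pos (one_sub_mul_sq_pos ha ha1 hs0 hs1)
      (one_sub_sq_pos hs0 hs1))) (sphereArea_pos _)).ne'
  rw [IntegrableOn, IntegrableOn,
    ← integrable_smul_iff hc (radonIntegrand₀ n (opU₀ n a f₀) (radonOffset a s))]
  refine integrableOn_congr_fun (fun r hr => ?_) measurableSet_Ioi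
  simp only [Pi.smul_apply, radonIntegrand₀, opU₀, smul_smul]
  rw [deriv_mul_sliceDensity ha ha1 hs0 hs1 hn hr]

theorem integral_sliceDensity {n : ℕ} (hn : 2 ≤ n) (f₀ : ℝ → ℂ) :
    ∫ h in Ioo (sliceBottom a s) a, sliceDensity n a s h • f₀ h =
      opV₀ a (radon₀ n (opU₀ n a f₀)) s := by
  rw [← image_Q₀ ha ha1 hs0 hs1, integral_image_eq_integral_abs_deriv_smul
    measurableSet_Ioi (fun r _ => (hasDerivAt_Q₀ ha ha1 r).hasDerivWithinAt)
    (injOn_Q₀ ha ha1 hs0), opV₀, radon₀, smul_smul, ← integral_smul]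
  refine setIntegral_congr_fun measurableSet_Ioi (fun r hr => ?_)
  simp only [radonIntegrand₀, opU₀, smul_smul]
  rw [deriv_mul_sliceDensity ha ha1 hs0 hs1 hn hr]

end

/-! ### The Radon transform of radial functions, by y = √(r²-t²). -/

section Substitution

variable {t : ℝ} (ht : 0 ≤ t)
include ht

theorem image_sqrt_sq_sub_sq : (fun r => √(r ^ 2 - t ^ 2)) '' Ioi t = Ioi 0 := by
  ext y
  constructor
  · rintro ⟨r, hr, rfl⟩
    have : t < r := hr
    exact Real.sqrt_pos.2 (by nlinarith)
  · intro hy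
    have hy0 : 0 < y := hy
    refine ⟨√(t ^ 2 + y ^ 2), Real.lt_sqrt_of_sq_lt (by nlinarith), ?_⟩
    simp only
    rw [Real.sq_sqrt (by positivity), add_sub_cancel_left, Real.sqrt_sq hy0.le]

theorem injOn_sqrt_sq_sub_sq : InjOn (fun r => √(r ^ 2 - t ^ 2)) (Ioi t) := by
  intro r hr q hq h
  have hr' : t < r := hr
  have hq' : t < q := hq
  have h1 := (Real.sqrt_inj (by nlinarith) (by nlinarith)).1 h
  exact (pow_left_inj₀ (by linarith) (by linarith) two_ne_zero).1 (by linarith : r ^ 2 = q ^ 2)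

theorem hasDerivAt_sqrt_sq_sub_sq {r : ℝ} (hr : t < r) :
    HasDerivAt (fun r => √(r ^ 2 - t ^ 2)) (r / √(r ^ 2 - t ^ 2)) r := by
  have h1 : HasDerivAt (fun r : ℝ => r ^ 2 - t ^ 2) (2 * r) r := by
    simpa using (hasDerivAt_pow 2 r).sub_const (t ^ 2)
  convert! h1.sqrt (by nlinarith : r ^ 2 - t ^ 2 ≠ 0) using 1
  rw [mul_div_mul_left _ _ two_ne_zero]

/-- The polar weight y^{n-2} of θ^⊥ times dy = (r/y) dr is y^{n-3} r dr. -/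
theorem deriv_smul_radial {n : ℕ} (hn : 2 ≤ n) (g : ℝ → ℂ) {r : ℝ} (hr : t < r) :
    |r / √(r ^ 2 - t ^ 2)| • (√(r ^ 2 - t ^ 2) ^ (n - 2) • g √(t ^ 2 + √(r ^ 2 - t ^ 2) ^ 2)) =
      radonIntegrand₀ n g t r := by
  have hr0 : 0 < r := ht.trans_lt hr
  have h1 : 0 < r ^ 2 - t ^ 2 := by nlinarith
  have h2 := Real.sqrt_pos.2 h1
  rw [Real.sq_sqrt h1.le, add_sub_cancel, Real.sqrt_sq hr0.le, radonIntegrand₀, smul_smul,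
    abs_of_pos (by positivity)]
  congr 1
  have h3 : (r ^ 2 - t ^ 2) ^ (((n : ℝ) - 3) / 2) =
      √(r ^ 2 - t ^ 2) ^ (n - 2) * (√(r ^ 2 - t ^ 2))⁻¹ := by
    rw [← Real.rpow_natCast _ (n - 2), Real.sqrt_eq_rpow, ← Real.rpow_neg h1.le, ← Real.rpow_mul h1.le,
      ← Real.rpow_add h1]
    congr 1
    push_cast [Nat.cast_sub hn]
    ring
  rw [h3]
  ring

/-- The Radon transform of a radial function, with simultaneous existence. -/
theorem radonIntegrable_radial_iff {n : ℕ} (hn : 2 ≤ n) (g : ℝ → ℂ) {θ : E n} (hθ : ‖θ‖ = 1) :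
    RadonIntegrable (fun x : E n => g ‖x‖) θ t ↔
      IntegrableOn (radonIntegrand₀ n g t) (Ioi t) := by
  have hK : finrank ℝ (Submodule.span ℝ {θ})ᗮ = n - 1 := by
    rw [finrank_orthogonal_span hθ, finrank_E]
  have : Nontrivial (Submodule.span ℝ {θ})ᗮ := nontrivial_of_finrank_pos (R := ℝ) (by omega)
  simp only [RadonIntegrable, norm_smul_add_orthogonal hθ]
  rw [integrable_fun_norm_addHaar (volume : Measure (Submodule.span ℝ {θ})ᗮ)
    (f := fun y => g √(t ^ 2 + y ^ 2)), hK, ← image_sqrt_sq_sub_sq ht,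
    integrableOn_image_iff_integrableOn_abs_deriv_smul measurableSet_Ioi
      (fun r hr => (hasDerivAt_sqrt_sq_sub_sq ht hr).hasDerivWithinAt) (injOn_sqrt_sq_sub_sq ht)]
  exact integrableOn_congr_fun (fun r hr => deriv_smul_radial ht hn g hr) measurableSet_Ioi

theorem radon_radial {n : ℕ} (hn : 2 ≤ n) (g : ℝ → ℂ) {θ : E n} (hθ : ‖θ‖ = 1) :
    radon (fun x : E n => g ‖x‖) θ t = radon₀ n g t := by
  have hK : finrank ℝ (Submodule.span ℝ {θ})ᗮ = n - 1 := by
    rw [finrank_orthogonal_span hθ, finrank_E]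
  have : Nontrivial (Submodule.span ℝ {θ})ᗮ := nontrivial_of_finrank_pos (R := ℝ) (by omega)
  -- Polar integration over θ^⊥ produces the constant (n-1)·vol(ball), which is σ_{n-2}.
  have hσ := sphereArea_eq_dim_mul_ball (F := (Submodule.span ℝ {θ})ᗮ)
  rw [hK] at hσ
  simp only [radon, norm_smul_add_orthogonal hθ]
  rw [integral_fun_norm_addHaar (volume : Measure (Submodule.span ℝ {θ})ᗮ)
    (fun y => g √(t ^ 2 + y ^ 2)), hK, ← image_sqrt_sq_sub_sq ht,
    integral_image_eq_integral_abs_deriv_smul measurableSet_Ioi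
      (fun r hr => (hasDerivAt_sqrt_sq_sub_sq ht hr).hasDerivWithinAt) (injOn_sqrt_sq_sub_sq ht),
    ← smul_assoc, nsmul_eq_mul, ← hσ, radon₀]
  congr 1
  exact setIntegral_congr_fun measurableSet_Ioi (fun r hr => deriv_smul_radial ht hn g hr)

end Substitution

/-! ### Reduction of U_a f to a radial function. -/

section

variable {n : ℕ} {a : ℝ}

theorem norm_sq_eq_horizontal (ξ : E (n + 1)) : ‖ξ‖ ^ 2 = ‖horizontal ξ‖ ^ 2 + height ξ ^ 2 := by
  simp [EuclideanSpace.norm_sq_eq, Fin.sum_univ_castSucc, horizontal, height]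

theorem horizontal_withHeight (x : E n) (q : ℝ) : horizontal (withHeight x q) = x := by
  ext i
  simp [horizontal, withHeight]

theorem height_withHeight (x : E n) (q : ℝ) : height (withHeight x q) = q := by
  simp [height, withHeight]

theorem height_stereo (x : E n) : height (stereo a x) = Q₀ a ‖x‖ := height_withHeight _ _

theorem stereo_mem (ha : -1 < a) (ha1 : a ≤ 1) (x : E n) : stereo a x ∈ truncatedSphere n a := by
  refine ⟨?_, ?_⟩
  · have h : ‖stereo a x‖ ^ 2 = 1 := by
      rw [norm_sq_eq_horizontal, height_stereo, stereo, horizontal_withHeight, norm_smul, mul_pow,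
        Real.norm_eq_abs, sq_abs, add_comm, Q₀_sq_add ha ha1]
    exact (pow_eq_one_iff_of_nonneg (norm_nonneg _) two_ne_zero).1 h
  · rw [height_stereo]
    exact Q₀_lt ha ha1 _

theorem opU_eq_opU₀ (ha : -1 < a) (ha1 : a ≤ 1) {f₀ : ℝ → ℂ} {f : E (n + 1) → ℂ}
    (hf : ∀ η ∈ truncatedSphere n a, f η = f₀ (height η)) :
    opU a f = fun x => opU₀ n a f₀ ‖x‖ := by
  ext x
  rw [opU, hf _ (stereo_mem ha ha1 x), height_stereo, opU₀]

theorem norm_direction {ξ : E (n + 1)} (hξ : ‖ξ‖ = 1) (hs0 : 0 ≤ height ξ) (hs1 : height ξ < 1) :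
    ‖direction ξ‖ = 1 := by
  have hw := one_sub_sq_pos hs0 hs1
  have h := norm_sq_eq_horizontal ξ
  rw [hξ] at h
  have h1 : ‖horizontal ξ‖ = √(1 - height ξ ^ 2) := by
    rw [eq_comm, Real.sqrt_eq_iff_mul_self_eq hw.le (norm_nonneg _)]
    linarith
  have := Real.sqrt_pos.2 hw
  rw [direction, norm_smul, h1, norm_inv, Real.norm_of_nonneg this.le, inv_mul_cancel₀ this.ne']

end

/-! ### The cases a = 0 and a = 1. -/

theorem integrableOn_iff_of_eqOn_smul {F G : ℝ → ℂ} {S : Set ℝ} {c : ℝ} (hS : MeasurableSet S)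
    (hc : c ≠ 0) (h : ∀ x ∈ S, F x = c • G x) : IntegrableOn F S ↔ IntegrableOn G S := by
  rw [integrableOn_congr_fun h hS]
  exact integrable_smul_iff hc G

theorem setIntegral_eq_of_eqOn_smul {F G : ℝ → ℂ} {S : Set ℝ} {c : ℝ} (hS : MeasurableSet S)
    (h : ∀ x ∈ S, F x = c • G x) : ∫ x in S, F x = c • ∫ x in S, G x := by
  rw [setIntegral_congr_fun hS h]
  exact integral_smul c G

section

variable {s : ℝ} (hs0 : 0 ≤ s) (hs1 : s < 1)
include hs0 hs1

/-- With ρ = √(1-s²) the base is (ρ²-t²)/ρ² and the prefactor 1/ρ, so ρ·ρ^{n-3} = ρ^{n-2} appears in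
the denominator. -/
theorem sliceDensity_zero {n : ℕ} (hn : 2 ≤ n) (f₀ : ℝ → ℂ) {t : ℝ}
    (ht : t ∈ Ioo 0 √(1 - s ^ 2)) :
    sliceDensity n 0 s (-t) • f₀ (-t) = (sphereArea (n - 2) / √(1 - s ^ 2) ^ (n - 2)) •
      abelIntegrandZero n f₀ √(1 - s ^ 2) t := by
  have hw := one_sub_sq_pos hs0 hs1
  have hw' := Real.sqrt_pos.2 hw
  have hwsq := Real.sq_sqrt hw.le
  rw [abelIntegrandZero, smul_smul]
  congr 1
  have hb : (1 - (-t) ^ 2 - s ^ 2 * (1 + (0 : ℝ) ^ 2 - 2 * 0 * (-t))) / (1 - s ^ 2) =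
      (√(1 - s ^ 2) ^ 2 - t ^ 2) / √(1 - s ^ 2) ^ (2 : ℝ) := by
    rw [Real.rpow_two, hwsq]
    ring
  have hb' : (1 - (0 : ℝ) ^ 2 * s ^ 2) / (1 - s ^ 2) = 1 / (1 - s ^ 2) := by ring
  have hpos : 0 ≤ √(1 - s ^ 2) ^ 2 - t ^ 2 := by nlinarith [ht.1, ht.2]
  rw [sliceDensity, hb, hb', Real.sqrt_div zero_le_one, Real.sqrt_one,
    Real.div_rpow hpos (by positivity), ← Real.rpow_mul hw'.le]
  have hp : √(1 - s ^ 2) ^ (n - 2) =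
      √(1 - s ^ 2) * √(1 - s ^ 2) ^ (2 * (((n : ℝ) - 3) / 2)) := by
    nth_rewrite 2 [← Real.rpow_one √(1 - s ^ 2)]
    rw [← Real.rpow_add hw', ← Real.rpow_natCast]
    congr 1
    push_cast [Nat.cast_sub hn]
    ring
  rw [hp]
  field_simp

omit hs0 hs1 in
theorem image_neg_Ioo_sliceBottom (s : ℝ) :
    (fun t : ℝ => -t) '' Ioo 0 √(1 - s ^ 2) = Ioo (sliceBottom 0 s) 0 := by
  rw [Set.image_neg_eq_neg, Set.neg_Ioo]
  simp [sliceBottom]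

theorem integrableOn_sliceDensity_zero_iff {n : ℕ} (hn : 2 ≤ n) (f₀ : ℝ → ℂ) :
    IntegrableOn (fun h => sliceDensity n 0 s h • f₀ h) (Ioo (sliceBottom 0 s) 0) ↔
      IntegrableOn (abelIntegrandZero n f₀ √(1 - s ^ 2)) (Ioo 0 √(1 - s ^ 2)) := by
  have hw := Real.sqrt_pos.2 (one_sub_sq_pos hs0 hs1)
  rw [← image_neg_Ioo_sliceBottom, integrableOn_image_iff_integrableOn_abs_deriv_smul
    measurableSet_Ioo (fun t _ => (hasDerivAt_neg t).hasDerivWithinAt) neg_injective.injOn]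
  refine integrableOn_iff_of_eqOn_smul measurableSet_Ioo
    (div_pos (sphereArea_pos (n - 2)) (pow_pos hw (n - 2))).ne' fun t ht => ?_
  rw [abs_neg, abs_one, one_smul, sliceDensity_zero hs0 hs1 hn f₀ ht]

theorem integral_sliceDensity_zero {n : ℕ} (hn : 2 ≤ n) (f₀ : ℝ → ℂ) :
    ∫ h in Ioo (sliceBottom 0 s) 0, sliceDensity n 0 s h • f₀ h =
      abelZero n f₀ √(1 - s ^ 2) := by
  rw [← image_neg_Ioo_sliceBottom, integral_image_eq_integral_abs_deriv_smul
    measurableSet_Ioo (fun t _ => (hasDerivAt_neg t).hasDerivWithinAt) neg_injective.injOn]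
  refine setIntegral_eq_of_eqOn_smul measurableSet_Ioo fun t ht => ?_
  rw [abs_neg, abs_one, one_smul, sliceDensity_zero hs0 hs1 hn f₀ ht]

theorem sliceBottom_one : sliceBottom 1 s = 2 * s ^ 2 - 1 := by
  have hw := one_sub_sq_pos hs0 hs1
  rw [sliceBottom, one_pow, one_mul, Real.mul_self_sqrt hw.le]
  ring

/-- For a = 1 the upper end of the full slice is 1, so the base factors into (h-ρ)(1-h) with ρ =
2s²-1, and the square-root prefactor is 1. -/
theorem sliceDensity_one (n : ℕ) (f₀ : ℝ → ℂ) {h : ℝ} (hh : h ∈ Ioo (2 * s ^ 2 - 1) 1) :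
    sliceDensity n 1 s h • f₀ h = (sphereArea (n - 2) *
      ((1 - (2 * s ^ 2 - 1)) / 2) ^ ((3 - (n : ℝ)) / 2)) •
        abelIntegrandOne n f₀ (2 * s ^ 2 - 1) h := by
  have hw := one_sub_sq_pos hs0 hs1
  rw [abelIntegrandOne, smul_smul]
  congr 1
  have h1 : 0 ≤ h - (2 * s ^ 2 - 1) := by linarith [hh.1]
  have h2 : 0 ≤ 1 - h := by linarith [hh.2]
  have hb : (1 - h ^ 2 - s ^ 2 * (1 + 1 ^ 2 - 2 * 1 * h)) / (1 - s ^ 2) =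
      (h - (2 * s ^ 2 - 1)) * (1 - h) / (1 - s ^ 2) := by ring
  have hb' : (1 - (1 : ℝ) ^ 2 * s ^ 2) / (1 - s ^ 2) = 1 := by
    rw [one_pow, one_mul, div_self hw.ne']
  have hb'' : (1 - (2 * s ^ 2 - 1)) / 2 = 1 - s ^ 2 := by ring
  have he : (3 - (n : ℝ)) / 2 = -(((n : ℝ) - 3) / 2) := by ring
  rw [sliceDensity, hb, hb', hb'', he, Real.sqrt_one, Real.div_rpow (mul_nonneg h1 h2) hw.le,
    Real.mul_rpow h1 h2, Real.rpow_neg hw.le]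
  ring

theorem integrableOn_sliceDensity_one_iff (n : ℕ) (f₀ : ℝ → ℂ) :
    IntegrableOn (fun h => sliceDensity n 1 s h • f₀ h) (Ioo (sliceBottom 1 s) 1) ↔
      IntegrableOn (abelIntegrandOne n f₀ (2 * s ^ 2 - 1)) (Ioo (2 * s ^ 2 - 1) 1) := by
  have hw := one_sub_sq_pos hs0 hs1
  rw [sliceBottom_one hs0 hs1]
  refine integrableOn_iff_of_eqOn_smul measurableSet_Ioo
    (mul_pos (sphereArea_pos (n - 2)) (Real.rpow_pos_of_pos ?_ _)).ne'
    fun h hh => sliceDensity_one hs0 hs1 n f₀ hh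
  linarith

theorem integral_sliceDensity_one (n : ℕ) (f₀ : ℝ → ℂ) :
    ∫ h in Ioo (sliceBottom 1 s) 1, sliceDensity n 1 s h • f₀ h =
      abelOne n f₀ (2 * s ^ 2 - 1) := by
  rw [sliceBottom_one hs0 hs1]
  exact setIntegral_eq_of_eqOn_smul measurableSet_Ioo fun h hh => sliceDensity_one hs0 hs1 n f₀ hh

end

/-! ### Existence of the integrals for almost every ξ. -/

/-- The power `x₊^p`, with value `0` for `x ≤ 0`. -/
noncomputable def posPow (p x : ℝ) : ENNReal :=
  (Ioi (0 : ℝ)).indicator (fun x => ENNReal.ofReal (x ^ p)) x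

theorem posPow_of_pos (p : ℝ) {x : ℝ} (hx : 0 < x) : posPow p x = ENNReal.ofReal (x ^ p) :=
  indicator_of_mem (mem_Ioi.2 hx) _

theorem posPow_of_nonpos (p : ℝ) {x : ℝ} (hx : x ≤ 0) : posPow p x = 0 :=
  indicator_of_notMem (by simpa using hx) _

@[fun_prop]
theorem measurable_posPow (p : ℝ) : Measurable (posPow p) :=
  Measurable.indicator (by fun_prop) measurableSet_Ioi

theorem posPow_mul (p : ℝ) {c : ℝ} (hc : 0 < c) (x : ℝ) :
    posPow p (c * x) = ENNReal.ofReal (c ^ p) * posPow p x := by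
  rcases lt_or_ge 0 x with hx | hx
  · rw [posPow_of_pos p hx, posPow_of_pos p (mul_pos hc hx), Real.mul_rpow hc.le hx.le,
      ENNReal.ofReal_mul (by positivity)]
  · rw [posPow_of_nonpos p hx, posPow_of_nonpos p (mul_nonpos_of_nonneg_of_nonpos hc.le hx),
      mul_zero]

/-- Up to the factor σ_{n-2} this is the area of S^{n-1}; the singular exponent -1/2 at n = 2 needs
no separate treatment. -/
theorem lintegral_one_sub_sq_rpow_lt_top {n : ℕ} (hn : 2 ≤ n) :
    ∫⁻ u in Ioo (-1 : ℝ) 1, ENNReal.ofReal ((1 - u ^ 2) ^ (((n : ℝ) - 3) / 2)) < ⊤ := by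
  have : Nontrivial (E n) := nontrivial_of_finrank_pos (R := ℝ) (by rw [finrank_E]; omega)
  obtain ⟨e, he⟩ := exists_norm_eq (E n) zero_le_one
  have h := lintegral_toSphere_inner hn (finrank_E n) he (φ := fun _ => 1) measurable_const
  simp only [mul_one, lintegral_one] at h
  refine ENNReal.lt_top_of_mul_ne_top_right (h ▸ measure_ne_top _ _) ?_
  simpa using sphereArea_pos (n - 2)

theorem lintegral_posPow_lt_top {n : ℕ} (hn : 2 ≤ n) :
    ∫⁻ v in Ioi (0 : ℝ), posPow (((n : ℝ) - 3) / 2) (1 - v ^ 2) < ⊤ := by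
  refine lt_of_le_of_lt ?_ (lintegral_one_sub_sq_rpow_lt_top hn)
  rw [← lintegral_indicator measurableSet_Ioi, ← lintegral_indicator measurableSet_Ioo]
  refine lintegral_mono fun v => ?_
  by_cases h1 : v ∈ Ioi (0 : ℝ)
  · rw [indicator_of_mem h1]
    rcases lt_or_ge 0 (1 - v ^ 2) with h2 | h2
    · have hv : v ∈ Ioo (-1 : ℝ) 1 := by
        have : 0 < v := h1
        constructor <;> nlinarith
      rw [indicator_of_mem hv, posPow_of_pos _ h2]
    · rw [posPow_of_nonpos _ h2]
      exact zero_le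
  · rw [indicator_of_notMem h1]
    exact zero_le

/-- Scaling s = √(A/B) v turns A - s²B into A(1-v²). -/
theorem lintegral_posPow_sub_mul (p : ℝ) {A B : ℝ} (hA : 0 < A) (hB : 0 < B) :
    ∫⁻ s in Ioi (0 : ℝ), posPow p (A - s ^ 2 * B) =
      ENNReal.ofReal (√(A / B) * A ^ p) * ∫⁻ v in Ioi (0 : ℝ), posPow p (1 - v ^ 2) := by
  have hc : 0 < √(A / B) := Real.sqrt_pos.2 (div_pos hA hB)
  have himg : (fun v => √(A / B) * v) '' Ioi 0 = Ioi 0 := by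
    ext s
    constructor
    · rintro ⟨v, hv, rfl⟩
      exact mul_pos hc hv
    · intro hs
      exact ⟨s / √(A / B), div_pos hs hc, mul_div_cancel₀ _ hc.ne'⟩
  rw [← himg, lintegral_image_eq_lintegral_abs_deriv_mul measurableSet_Ioi
    (f' := fun _ => √(A / B)) (fun v _ => by
      simpa using ((hasDerivAt_id v).const_mul √(A / B)).hasDerivWithinAt)
    (mul_right_injective₀ hc.ne').injOn, himg, ← lintegral_const_mul' _ _ ENNReal.ofReal_ne_top]
  refine lintegral_congr fun v => ?_
  have h1 : A - (√(A / B) * v) ^ 2 * B = A * (1 - v ^ 2) := by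
    rw [mul_pow, Real.sq_sqrt (by positivity)]
    field_simp
  rw [h1, posPow_mul p hA, abs_of_pos hc, ← mul_assoc, ENNReal.ofReal_mul hc.le]

theorem one_add_sq_sub_pos {a h : ℝ} (ha1 : a ≤ 1) (hh : h ∈ Ioo (-1) a) :
    0 < 1 + a ^ 2 - 2 * a * h := by
  nlinarith [hh.1, hh.2, sq_nonneg (a - h)]

theorem zonalWeight_nonneg {n : ℕ} {a h : ℝ} (ha1 : a ≤ 1) (hh : h ∈ Ioo (-1) a) :
    0 ≤ zonalWeight n a h := by
  have h1 : 0 < 1 + h := by linarith [hh.1]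
  have h2 : 0 < 1 - h := by linarith [hh.2]
  have h3 : 0 < 1 - h ^ 2 := by nlinarith
  unfold zonalWeight
  split_ifs <;> positivity

/-- The weight controls the integral of the slice densities over the height of the slice. -/
theorem exists_le_mul_zonalWeight (n : ℕ) {a : ℝ} (ha : -1 < a) (ha1 : a ≤ 1) :
    ∃ C : ℝ, 0 ≤ C ∧ ∀ h ∈ Ioo (-1) a,
      √((1 - h ^ 2) / (1 + a ^ 2 - 2 * a * h)) * (1 - h ^ 2) ^ (((n : ℝ) - 3) / 2) ≤
        C * zonalWeight n a h := by
  rcases ha1.lt_or_eq with hlt | rfl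
  -- The denominator 1+a²-2ah is affine in h; these are its values at h = -1 and h = a, both
  -- positive when a < 1.
  · have hc : 0 < min ((1 + a) ^ 2) (1 - a ^ 2) :=
      lt_min (by nlinarith) (by nlinarith)
    refine ⟨(√(min ((1 + a) ^ 2) (1 - a ^ 2)))⁻¹, by positivity, fun h hh => ?_⟩
    have hA : 0 < 1 - h ^ 2 := by nlinarith [hh.1, hh.2]
    have hB : min ((1 + a) ^ 2) (1 - a ^ 2) ≤ 1 + a ^ 2 - 2 * a * h := by
      rcases le_or_gt a 0 with h0 | h0
      · exact (min_le_left _ _).trans (by nlinarith [hh.1])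
      · exact (min_le_right _ _).trans (by nlinarith [hh.2])
    have hp : (1 - h ^ 2) ^ (((n : ℝ) - 2) / 2) =
        √(1 - h ^ 2) * (1 - h ^ 2) ^ (((n : ℝ) - 3) / 2) := by
      rw [Real.sqrt_eq_rpow, ← Real.rpow_add hA]
      congr 1
      ring
    rw [zonalWeight, if_pos hlt, hp, ← mul_assoc, Real.sqrt_div hA.le, div_eq_inv_mul]
    gcongr
  -- For a = 1 the denominator is 2(1-h) and cancels a factor of 1-h², which costs the weight half a
  -- power of 1-h; equality holds with this constant.
  · refine ⟨(√2)⁻¹, by positivity, fun h hh => ?_⟩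
    have h1 : 0 < 1 + h := by linarith [hh.1]
    have h2 : 0 < 1 - h := by linarith [hh.2]
    have hq : (1 - h ^ 2) / (1 + 1 ^ 2 - 2 * 1 * h) = (1 + h) / 2 := by
      rw [show 1 + 1 ^ 2 - 2 * 1 * h = 2 * (1 - h) by ring]
      field_simp
      ring
    have hm : 1 - h ^ 2 = (1 - h) * (1 + h) := by ring
    have hp : (1 + h) ^ (((n : ℝ) - 2) / 2) = √(1 + h) * (1 + h) ^ (((n : ℝ) - 3) / 2) := by
      rw [Real.sqrt_eq_rpow, ← Real.rpow_add h1]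
      congr 1
      ring
    rw [zonalWeight, if_neg (lt_irrefl _), hq, hm, hp, Real.mul_rpow h2.le h1.le,
      Real.sqrt_div h1.le]
    apply le_of_eq
    ring

section

variable {n : ℕ} {a : ℝ} {f₀ : ℝ → ℂ}

/-- Tonelli: a finite double integral has almost all inner integrals finite. The truncated power
allows both variables to range over fixed intervals. -/
theorem ae_lintegral_posPow_lt_top (hn : 2 ≤ n) (ha : -1 < a) (ha1 : a ≤ 1)
    (hf₀ : AEStronglyMeasurable f₀ (volume.restrict (Ioo (-1) a)))
    (hI : IntegrableOn (fun t => zonalWeight n a t • f₀ t) (Ioo (-1) a)) :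
    ∀ᵐ s ∂volume.restrict (Ioi (0 : ℝ)), ∫⁻ h in Ioo (-1) a,
      posPow (((n : ℝ) - 3) / 2) (1 - h ^ 2 - s ^ 2 * (1 + a ^ 2 - 2 * a * h)) * ‖f₀ h‖ₑ < ⊤ := by
  have hmeas : AEMeasurable (Function.uncurry fun s h : ℝ =>
      posPow (((n : ℝ) - 3) / 2) (1 - h ^ 2 - s ^ 2 * (1 + a ^ 2 - 2 * a * h)) * ‖f₀ h‖ₑ)
      ((volume.restrict (Ioi (0 : ℝ))).prod (volume.restrict (Ioo (-1) a))) := by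
    refine AEMeasurable.mul ?_ hf₀.comp_snd.enorm
    exact Measurable.aemeasurable (by fun_prop)
  refine ae_lt_top' hmeas.lintegral_prod_right' ?_
  rw [lintegral_lintegral_swap hmeas]
  obtain ⟨C, hC, hle⟩ := exists_le_mul_zonalWeight n ha ha1
  have hbound : ∫⁻ h in Ioo (-1) a, ∫⁻ s in Ioi (0 : ℝ),
      posPow (((n : ℝ) - 3) / 2) (1 - h ^ 2 - s ^ 2 * (1 + a ^ 2 - 2 * a * h)) * ‖f₀ h‖ₑ ≤
      ∫⁻ h in Ioo (-1) a, (ENNReal.ofReal C *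
        ∫⁻ v in Ioi (0 : ℝ), posPow (((n : ℝ) - 3) / 2) (1 - v ^ 2)) *
          ‖zonalWeight n a h • f₀ h‖ₑ := by
    refine setLIntegral_mono' measurableSet_Ioo fun h hh => ?_
    have hA : 0 < 1 - h ^ 2 := by nlinarith [hh.1, hh.2]
    rw [lintegral_mul_const _ (by fun_prop),
      lintegral_posPow_sub_mul _ hA (one_add_sq_sub_pos ha1 hh), enorm_smul,
      Real.enorm_of_nonneg (zonalWeight_nonneg ha1 hh)]
    calc _ ≤ ENNReal.ofReal (C * zonalWeight n a h) *
          (∫⁻ v in Ioi (0 : ℝ), posPow (((n : ℝ) - 3) / 2) (1 - v ^ 2)) * ‖f₀ h‖ₑ := by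
          gcongr ENNReal.ofReal ?_ * _ * _
          exact hle h hh
      _ = _ := by
          rw [ENNReal.ofReal_mul hC]
          ring
  refine (hbound.trans_lt ?_).ne
  have hfin : ENNReal.ofReal C *
      ∫⁻ v in Ioi (0 : ℝ), posPow (((n : ℝ) - 3) / 2) (1 - v ^ 2) < ⊤ :=
    ENNReal.mul_lt_top ENNReal.ofReal_lt_top (lintegral_posPow_lt_top hn)
  rw [lintegral_const_mul' _ _ hfin.ne]
  exact ENNReal.mul_lt_top hfin hI.2

theorem ae_integrableOn_sliceDensity (hn : 2 ≤ n) (ha : -1 < a) (ha1 : a ≤ 1)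
    (hf₀ : AEStronglyMeasurable f₀ (volume.restrict (Ioo (-1) a)))
    (hI : IntegrableOn (fun t => zonalWeight n a t • f₀ t) (Ioo (-1) a)) :
    ∀ᵐ s : ℝ, 0 ≤ s → s < 1 →
      IntegrableOn (fun h => sliceDensity n a s h • f₀ h) (Ioo (sliceBottom a s) a) := by
  have h1 := ae_lintegral_posPow_lt_top hn ha ha1 hf₀ hI
  rw [restrict_Ioi_eq_restrict_Ici, ae_restrict_iff' measurableSet_Ici] at h1
  filter_upwards [h1] with s hs hs0 hs1
  have hw := one_sub_sq_pos hs0 hs1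
  have hsub : Ioo (sliceBottom a s) a ⊆ Ioo (-1) a :=
    Ioo_subset_Ioo_left (neg_one_le_sliceBottom ha ha1 hs0 hs1)
  refine ⟨(measurable_sliceDensity n a s).aestronglyMeasurable.smul
    (hf₀.mono_measure (Measure.restrict_mono_set _ hsub)), ?_⟩
  -- The part of the density that depends on s alone, finite for each s < 1.
  set c := sphereArea (n - 2) * √((1 - a ^ 2 * s ^ 2) / (1 - s ^ 2)) /
    (1 - s ^ 2) ^ (((n : ℝ) - 3) / 2)
  have hc : 0 ≤ c := by
    have := sphereArea_pos (n - 2)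
    positivity
  have hle : ∫⁻ h in Ioo (sliceBottom a s) a, ‖sliceDensity n a s h • f₀ h‖ₑ ≤
      ∫⁻ h in Ioo (sliceBottom a s) a, ENNReal.ofReal c *
        (posPow (((n : ℝ) - 3) / 2) (1 - h ^ 2 - s ^ 2 * (1 + a ^ 2 - 2 * a * h)) * ‖f₀ h‖ₑ) := by
    refine setLIntegral_mono' measurableSet_Ioo fun h hh => le_of_eq ?_
    have hb := sliceDensity_base_pos ha ha1 hs0 hs1 hh
    rw [enorm_smul, Real.enorm_of_nonneg (sliceDensity_pos ha ha1 hs0 hs1 n hh).le,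
      posPow_of_pos _ hb, ← mul_assoc, ← ENNReal.ofReal_mul hc, sliceDensity,
      Real.div_rpow hb.le hw.le, mul_div_assoc', mul_div_right_comm]
  refine hle.trans_lt ?_
  rw [lintegral_const_mul' _ _ ENNReal.ofReal_ne_top]
  exact ENNReal.mul_lt_top ENNReal.ofReal_lt_top ((lintegral_mono_set hsub).trans_lt (hs hs0))

/-- The height is a coordinate on S^n, so its distribution has a density. The restriction to (-1,1)
also discards the poles, where the slice formulas are not available. -/
theorem map_height_sphereMeasure_absolutelyContinuous (hn : 2 ≤ n) :
    (sphereMeasure n).map (fun ξ : sphere (0 : E (n + 1)) 1 => height (ξ : E (n + 1))) ≪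
      volume.restrict (Ioo (-1 : ℝ) 1) := by
  have hm : Measurable (fun ξ : sphere (0 : E (n + 1)) 1 => height (ξ : E (n + 1))) := by fun_prop
  refine Measure.AbsolutelyContinuous.mk fun s hs h0 => ?_
  have he : ‖(EuclideanSpace.single (Fin.last n) (1 : ℝ) : E (n + 1))‖ = 1 := by simp
  have h := lintegral_toSphere_inner (by omega : 2 ≤ n + 1) (finrank_E (n + 1)) he
    (φ := s.indicator 1) (measurable_one.indicator hs)
  simp only [inner_single_last] at h
  rw [← lintegral_indicator_one hs, lintegral_map (measurable_one.indicator hs) hm, sphereMeasure,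
    h]
  have hz : ∫⁻ u in Ioo (-1 : ℝ) 1, ENNReal.ofReal
      ((1 - u ^ 2) ^ ((((n + 1 : ℕ) : ℝ) - 3) / 2)) * s.indicator 1 u = 0 := by
    refine (lintegral_eq_zero_iff (by fun_prop (disch := exact hs))).2 ?_
    filter_upwards [measure_eq_zero_iff_ae_notMem.1 h0] with u hu
    simp [hu]
  rw [hz, mul_zero]

theorem ae_sliceIntegrable (hn : 2 ≤ n) (ha : -1 < a) (ha1 : a ≤ 1)
    (hf₀ : AEStronglyMeasurable f₀ (volume.restrict (Ioo (-1) a)))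
    {f : E (n + 1) → ℂ} (hf : ∀ η ∈ truncatedSphere n a, f η = f₀ (height η))
    (hI : IntegrableOn (fun t => zonalWeight n a t • f₀ t) (Ioo (-1) a)) :
    ∀ᵐ ξ : sphere (0 : E (n + 1)) 1 ∂(sphereMeasure n), 0 ≤ height (ξ : E (n + 1)) →
      SliceIntegrable a f (ξ : E (n + 1)) := by
  have hm : Measurable (fun ξ : sphere (0 : E (n + 1)) 1 => height (ξ : E (n + 1))) := by fun_prop
  have h1 : ∀ᵐ s ∂volume.restrict (Ioo (-1 : ℝ) 1), s < 1 ∧ (0 ≤ s → s < 1 →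
      IntegrableOn (fun h => sliceDensity n a s h • f₀ h) (Ioo (sliceBottom a s) a)) := by
    filter_upwards [ae_restrict_mem measurableSet_Ioo,
      ae_restrict_of_ae (ae_integrableOn_sliceDensity hn ha ha1 hf₀ hI)] with s hs hs'
    exact ⟨hs.2, hs'⟩
  have h2 := ae_of_ae_map (μ := sphereMeasure n) hm.aemeasurable
    ((map_height_sphereMeasure_absolutelyContinuous hn).ae_le h1)
  filter_upwards [h2] with ξ hξ hs0
  exact (sliceIntegrable_iff hn ha ha1 hf₀ hf (mem_sphere_zero_iff_norm.1 ξ.2) hs0 hξ.1).2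
    (hξ.2 hs0 hξ.1)

end

end SphericalSlice

theorem mainTheorem10 (n : ℕ) (hn : 2 ≤ n) (a : ℝ) (ha : -1 < a) (ha1 : a ≤ 1)
    (f₀ : ℝ → ℂ) (hf₀ : AEStronglyMeasurable f₀ (volume.restrict (Ioo (-1) a)))
    (f : E (n + 1) → ℂ) (hf : ∀ η ∈ truncatedSphere n a, f η = f₀ (height η)) :
    -- `S_a f` is zonal and equals `V_a R U_a f`, also in one-variable form
    (∀ ξ : E (n + 1), ‖ξ‖ = 1 → 0 ≤ height ξ → height ξ < 1 →
      (SliceIntegrable a f ξ ↔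
        RadonIntegrable (opU a f) (direction ξ) (radonOffset a (height ξ))) ∧
      (SliceIntegrable a f ξ ↔
        IntegrableOn (radonIntegrand₀ n (opU₀ n a f₀) (radonOffset a (height ξ)))
          (Ioi (radonOffset a (height ξ)))) ∧
      sliceTransform a f ξ = opV a (radon (opU a f)) ξ ∧
      sliceTransform a f ξ = opV₀ a (radon₀ n (opU₀ n a f₀)) (height ξ)) ∧
    -- the integrals exist for almost all `ξ` in the upper hemisphere
    (IntegrableOn (fun t => zonalWeight n a t • f₀ t) (Ioo (-1) a) →
      ∀ᵐ ξ : Metric.sphere (0 : E (n + 1)) 1 ∂(sphereMeasure n), 0 ≤ height (ξ : E (n + 1)) →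
        SliceIntegrable a f (ξ : E (n + 1))) ∧
    -- the case `a = 0`
    (a = 0 → ∀ ξ : E (n + 1), ‖ξ‖ = 1 → 0 ≤ height ξ → height ξ < 1 →
      (SliceIntegrable a f ξ ↔
        IntegrableOn (abelIntegrandZero n f₀ (Real.sqrt (1 - height ξ ^ 2)))
          (Ioo 0 (Real.sqrt (1 - height ξ ^ 2)))) ∧
      sliceTransform a f ξ = abelZero n f₀ (Real.sqrt (1 - height ξ ^ 2))) ∧
    -- the case `a = 1`
    (a = 1 → ∀ ξ : E (n + 1), ‖ξ‖ = 1 → 0 ≤ height ξ → height ξ < 1 →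
      (SliceIntegrable a f ξ ↔
        IntegrableOn (abelIntegrandOne n f₀ (2 * height ξ ^ 2 - 1))
          (Ioo (2 * height ξ ^ 2 - 1) 1)) ∧
      sliceTransform a f ξ = abelOne n f₀ (2 * height ξ ^ 2 - 1)) := by
  refine ⟨fun ξ hξ hs0 hs1 => ?_, fun hI => ae_sliceIntegrable hn ha ha1 hf₀ hf hI, ?_, ?_⟩
  · have ht := radonOffset_nonneg ha hs0
    have hθ := norm_direction hξ hs0 hs1
    have h1 := (sliceIntegrable_iff hn ha ha1 hf₀ hf hξ hs0 hs1).trans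
      (integrableOn_sliceDensity_iff ha ha1 hs0 hs1 hn f₀)
    have h2 := (sliceTransform_eq hn ha ha1 hf₀ hf hξ hs0 hs1).trans
      (integral_sliceDensity ha ha1 hs0 hs1 hn f₀)
    refine ⟨?_, h1, ?_, h2⟩
    · rw [h1, opU_eq_opU₀ ha ha1 hf, radonIntegrable_radial_iff ht hn _ hθ]
    · rw [h2, opU_eq_opU₀ ha ha1 hf, opV, opV₀, radon_radial ht hn _ hθ]
  · rintro rfl ξ hξ hs0 hs1
    exact ⟨(sliceIntegrable_iff hn ha ha1 hf₀ hf hξ hs0 hs1).trans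
      (integrableOn_sliceDensity_zero_iff hs0 hs1 hn f₀),
      (sliceTransform_eq hn ha ha1 hf₀ hf hξ hs0 hs1).trans
      (integral_sliceDensity_zero hs0 hs1 hn f₀)⟩
  · rintro rfl ξ hξ hs0 hs1
    exact ⟨(sliceIntegrable_iff hn ha ha1 hf₀ hf hξ hs0 hs1).trans
      (integrableOn_sliceDensity_one_iff hs0 hs1 n f₀),
      (sliceTransform_eq hn ha ha1 hf₀ hf hξ hs0 hs1).trans
      (integral_sliceDensity_one hs0 hs1 n f₀)⟩
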